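/- Let $\mathbb K$ be a field, let $P$ be a finite subset of $\mathbb R^m$ and let $\mathscr V=(V_i)_{i\in I}$ be a finite cover of $P$ by subsets of $P$ whose nerve $N_{\mathscr V}$ (the simplices are the non-empty $\sigma\subseteq I$ with $\bigcap_{i\in\sigma}V_i\neq\emptyset$) has dimension at most one. Fix a total order on $I$ to orient the nerve. All homology has coefficients in $\mathbb K$. *The bound.* Minima over the empty set are $\infty$. If $p\in P$ lies in exactly one $V_i$, put $K_p=\min_{q\notin V_i}d(p,q)$. If $p\in V_i\cap V_j$ with $i\ne j$, put $K_p'=\min_{q\notin V_i\cup V_j}d(p,q)$, let $K_p''$ be the minimum of $d(q,q')$ over all $q\notin V_i$, $q'\notin V_j$ with $d(p,q)<K_p'$ and $d(p,q')<K_p'$, and put $K_p=\min\{K_p',K_p''\}$. Let $\epsilon_*=\min_{p\in P}K_p\in[0,\infty]$. *Notation.* Let $n\ge 0$ and let $0<\epsilon_1\le\dots\le\epsilon_N<\epsilon_*$ be parameters, $N\ge1$. Let $\mathscr R^i$ be the Vietoris–Rips complex of $P$ at $\epsilon_i$ (the simplices are the non-empty sets of points with pairwise distances $\le\epsilon_i$)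 and, for $\sigma\in N_{\mathscr V}$, let $\mathscr R^i_\sigma$ be that of $\bigcap_{j\in\sigma}V_j$. Chains are oriented simplicial chains, with $C_{-1}=0$. Let $\mathcal F^i_k$ be the cellular cosheaf $\sigma\mapsto H_k(\mathscr R^i_\sigma)$ on $N_{\mathscr V}$ with the maps induced by inclusions ($\mathcal F^i_{-1}=0$), $H_0(C_\bullet\mathcal F^i_k)$ and $H_1(C_\bullet\mathcal F^i_k)$ its cosheaf homology, and $\phi^i_k:\mathcal F^i_k\to\mathcal F^{i+1}_k$ the cosheaf morphism induced by inclusions. Let $e^i_k:\bigoplus_{e}C_k(\mathscr R^i_e)\to\bigoplus_{v}C_k(\mathscr R^i_v)$ (sums over the edges $e$ and the vertices $v$ of the nerve) be the boundary map of the cosheaf $\sigma\mapsto C_k(\mathscr R^i_\sigma)$, let $\iota^i_k$ and $\kappa^i_k$ be the inclusions, from parameter $\epsilon_i$ to $\epsilon_{i+1}$, of the $k$-chains over the vertices and over the edges, respectively, and let $\partial$ be the simplicial boundary. For a family $z$ of cycles over the vertices or over the edges, $\langle z\rangle$ is the family of homology classes and $\{\langle z\rangle\}$ the class of $\langle z\rangle$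 in cosheaf homology, when defined. Let $\mathbb V$ be the persistence module $H_n(\mathscr R^1)\to\dots\to H_n(\mathscr R^N)$ induced by inclusions. *The module $\mathbb V_\Psi$.* A consistent choice consists, for every $1\le i<N$, of a decomposition $H_1(C_\bullet\mathcal F^i_{n-1})=A^i\oplus\ker H_1(\phi^i_{n-1})$, bases $\mathscr B^i_A$ and $\mathscr B^i_{\ker}$ of the two summands with union $\mathscr B^i$, a family of cycles $b^*\in\bigoplus_eC_{n-1}(\mathscr R^i_e)$ with $\{\langle b^*\rangle\}=b$ for each $b\in\mathscr B^i$, a set map $\Gamma^i:\mathscr B^i\to\bigoplus_vC_n(\mathscr R^i_v)$ with $\partial\Gamma^i(b)=e^i_{n-1}b^*$, and elements $\alpha_b\in\bigoplus_eC_n(\mathscr R^{i+1}_e)$ with $\partial\alpha_b=\kappa^i_{n-1}b^*$ for $b\in\mathscr B^i_{\ker}$. For $i=1$ these are arbitrary. For $2\le i<N$ it is required that there are a basis $\mathscr C^i$ of $H_1(C_\bullet\mathcal F^i_{n-1})$ extending $\{H_1(\phi^{i-1}_{n-1})(b): b\in\mathscr B^{i-1}_A\}$, families of cycles $c^*$ representing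 the $c\in\mathscr C^i$, and a map $\Gamma^i_{\mathscr C}$ on $\mathscr C^i$ with $\partial\Gamma^i_{\mathscr C}(c)=e^i_{n-1}c^*$, such that $c^*=\kappa^{i-1}_{n-1}b^*$ and $\Gamma^i_{\mathscr C}(c)=\iota^{i-1}_n\Gamma^{i-1}(b)$ whenever $c=H_1(\phi^{i-1}_{n-1})(b)$ with $b\in\mathscr B^{i-1}_A$, and such that $b^*=\sum_c d_cc^*$ and $\Gamma^i(b)=\sum_c d_c\Gamma^i_{\mathscr C}(c)$ for each $b=\sum_c d_c\,c\in\mathscr B^i$. Given such a choice, let $\delta^i:\ker H_1(\phi^i_{n-1})\to H_0(C_\bullet\mathcal F^{i+1}_n)$ be the linear map with $\delta^i(b)=\{\langle -e^{i+1}_n\alpha_b+\iota^i_n\Gamma^i(b)\rangle\}$ for $b\in\mathscr B^i_{\ker}$, let $\psi^i$ be its extension to $H_1(C_\bullet\mathcal F^i_{n-1})$ by $0$ on $A^i$, and let $\mathbb V_\Psi$ be the persistence module with spaces $H_0(C_\bullet\mathcal F^i_n)\oplus H_1(C_\bullet\mathcal F^i_{n-1})$, $1\le i\le N$, and maps $$\Psi^i(x,y)=\bigl(H_0(\phi^i_n)(x)+(-1)^{n+1}\psi^i(y),\;H_1(\phi^i_{n-1})(y)\bigr).$$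 **Theorem.** $\epsilon_*>0$. For all $n$, $N$ and $\epsilon_1\le\dots\le\epsilon_N$ as above a consistent choice exists, and for every consistent choice the persistence modules $\mathbb V_\Psi$ and $\mathbb V$ are isomorphic: there are linear isomorphisms between their spaces that commute with the structure maps. -/

import Mathlib

open scoped ENNReal

noncomputable section

namespace DistPH

universe u v w x

/-! ## Homology of a sequence of linear maps -/

section Homology

variable {K : Type u} [Field K]
  {C : ℕ → Type v} [∀ k, AddCommGroup (C k)] [∀ k, Module K (C k)]
  {D : ℕ → Type w} [∀ k, AddCommGroup (D k)] [∀ k, Module K (D k)]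

/-- The cycles of `⋯ → C 2 → C 1 → C 0 → 0`. -/
def cycles (d : ∀ k, C (k + 1) →ₗ[K] C k) : ∀ k, Submodule K (C k)
  | 0 => ⊤
  | k + 1 => LinearMap.ker (d k)

/-- `H_k = ker / im` of `⋯ → C 2 → C 1 → C 0 → 0`. -/
abbrev Homology (d : ∀ k, C (k + 1) →ₗ[K] C k) (k : ℕ) : Type v :=
  cycles d k ⧸ (LinearMap.range (d k)).submoduleOf (cycles d k)

/-- The homology class of a cycle. -/
def homologyClass (d : ∀ k, C (k + 1) →ₗ[K] C k) (k : ℕ) : cycles d k →ₗ[K] Homology d k :=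
  ((LinearMap.range (d k)).submoduleOf (cycles d k)).mkQ

theorem map_mem_cycles {d : ∀ k, C (k + 1) →ₗ[K] C k} {d' : ∀ k, D (k + 1) →ₗ[K] D k}
    (f : ∀ k, C k →ₗ[K] D k) (hf : ∀ k c, f k (d k c) = d' k (f (k + 1) c)) :
    ∀ (k : ℕ) (c : C k), c ∈ cycles d k → f k c ∈ cycles d' k
  | 0, _, _ => Submodule.mem_top
  | k + 1, c, hc => by
    change d' k (f (k + 1) c) = 0
    have hc' : d k c = 0 := hc
    rw [← hf, hc', map_zero]

/-- The map induced on homology by a chain map. -/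
def homologyMap {d : ∀ k, C (k + 1) →ₗ[K] C k} {d' : ∀ k, D (k + 1) →ₗ[K] D k}
    (f : ∀ k, C k →ₗ[K] D k) (hf : ∀ k c, f k (d k c) = d' k (f (k + 1) c)) (k : ℕ) :
    Homology d k →ₗ[K] Homology d' k :=
  Submodule.mapQ _ _ ((f k).restrict (map_mem_cycles f hf k)) (by
    rintro ⟨c, hc⟩ ⟨b, hb⟩
    exact ⟨f (k + 1) b, by rw [← hf, hb]; rfl⟩)

theorem homologyMap_homologyClass {d : ∀ k, C (k + 1) →ₗ[K] C k}
    {d' : ∀ k, D (k + 1) →ₗ[K] D k}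
    (f : ∀ k, C k →ₗ[K] D k) (hf : ∀ k c, f k (d k c) = d' k (f (k + 1) c)) (k : ℕ)
    (c : cycles d k) :
    homologyMap f hf k (homologyClass d k c) =
      homologyClass d' k ⟨f k c, map_mem_cycles f hf k c c.2⟩ := rfl

end Homology

/-! ## Simplicial chains and simplicial homology -/

section Simplicial

variable (K : Type u) [Field K] {X : Type v}

/-- The oriented simplicial chains of `Δ` on simplices with `k` vertices, i.e. the space
`C_{k-1}(Δ)` of `(k-1)`-chains. A chain is a function of oriented simplices: its value at the
tuple `t = (v₁, …, v_k)` is the coefficient of the oriented simplex `[v₁, …, v_k]`, it is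
multiplied by `sign σ` when the vertices are permuted by `σ`, and it vanishes unless the entries of
`t` are the `k` distinct vertices of a simplex of `Δ`. Since simplices are non-empty, the space
for `k = 0` (the chains of degree `-1`) is zero. -/
def SimplicialChains (Δ : PreAbstractSimplicialComplex X) (k : ℕ) :
    Submodule K ((Fin k → X) → K) where
  carrier := {c | (∀ (t : Fin k → X) (σ : Equiv.Perm (Fin k)),
        c (t ∘ σ) = ((Equiv.Perm.sign σ : ℤ) : K) * c t) ∧
      ∀ t : Fin k → X, c t ≠ 0 →
        Function.Injective t ∧ ∃ s ∈ Δ, (s : Set X) = Set.range t}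
  zero_mem' := ⟨by simp, by simp⟩
  add_mem' := by
    rintro a b ⟨ha, ha'⟩ ⟨hb, hb'⟩
    refine ⟨fun t σ => by simp [ha t σ, hb t σ, mul_add], fun t ht => ?_⟩
    by_cases h : a t = 0
    · exact hb' t (fun h' => ht (by simp [h, h']))
    · exact ha' t h
  smul_mem' := by
    rintro r a ⟨ha, ha'⟩
    refine ⟨fun t σ => by simp [ha t σ, mul_left_comm], fun t ht => ha' t ?_⟩
    intro h
    exact ht (by simp [h])

/-- The inclusion of chains for a subcomplex. -/
def chainIncl {Δ Δ' : PreAbstractSimplicialComplex X} (h : Δ ≤ Δ') (k : ℕ) :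
    SimplicialChains K Δ k →ₗ[K] SimplicialChains K Δ' k :=
  Submodule.inclusion (fun _ hc => ⟨hc.1, fun t ht =>
    ⟨(hc.2 t ht).1, (hc.2 t ht).2.imp fun _ hs => ⟨h hs.1, hs.2⟩⟩⟩)

variable [Fintype X]

theorem boundary_mem {Δ : PreAbstractSimplicialComplex X} {k : ℕ}
    {c : (Fin (k + 1) → X) → K} (hc : c ∈ SimplicialChains K Δ (k + 1)) :
    (fun t : Fin k → X => if k = 0 then 0 else ∑ p : X, c (Fin.cons p t)) ∈
      SimplicialChains K Δ k := by
  obtain ⟨h1, h2⟩ := hc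
  refine ⟨fun t σ => ?_, fun t ht => ?_⟩
  · by_cases hk : k = 0
    · simp [hk]
    · simp only [hk, if_false, Finset.mul_sum]
      refine Finset.sum_congr rfl fun p _ => ?_
      have := h1 (Fin.cons p t) (Equiv.Perm.decomposeFin.symm (0, σ))
      rw [Equiv.Perm.decomposeFin.symm_sign] at this
      simp only [if_true, one_mul] at this
      rw [← this]
      congr 1
      funext j
      refine Fin.cases ?_ (fun j => ?_) j
      · simp
      · simp
  · by_cases hk : k = 0
    · simp [hk] at ht
    · simp only [hk, if_false] at ht
      obtain ⟨p, -, hp⟩ := Finset.exists_ne_zero_of_sum_ne_zero ht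
      obtain ⟨hinj, s, hs, hst⟩ := h2 _ hp
      have hinj' : Function.Injective t := by
        intro a b hab
        have : (Fin.cons p t : Fin (k + 1) → X) a.succ = (Fin.cons p t : Fin (k + 1) → X) b.succ := by
          simpa using hab
        exact Fin.succ_injective _ (hinj this)
      refine ⟨hinj', Finset.univ.map ⟨t, hinj'⟩, ?_, by simp⟩
      refine (Δ.isRelLowerSet_faces hs).2 ?_ ?_
      · intro y hy
        simp only [Finset.mem_map, Finset.mem_univ, true_and, Function.Embedding.coeFn_mk] at hy
        obtain ⟨a, rfl⟩ := hy
        have : t a ∈ (s : Set X) := by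
          rw [hst]
          exact ⟨a.succ, by simp⟩
        exact this
      · exact ⟨t ⟨0, Nat.pos_of_ne_zero hk⟩, by simp⟩

/-- The simplicial boundary operator. As `∂[p, v₁, …, v_k]` contains the term `[v₁, …, v_k]`
with coefficient `1`, the coefficient of `[v₁, …, v_k]` in `∂ c` is the sum over all points `p` of
the coefficient of `[p, v₁, …, v_k]` in `c`. The boundary of a `0`-chain is zero. -/
def simplicialBoundary (Δ : PreAbstractSimplicialComplex X) (k : ℕ) :
    SimplicialChains K Δ (k + 1) →ₗ[K] SimplicialChains K Δ k where
  toFun c := ⟨fun t => if k = 0 then 0 else ∑ p : X, c.1 (Fin.cons p t), boundary_mem K c.2⟩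
  map_add' a b := by
    ext t
    by_cases hk : k = 0 <;> simp [hk, Finset.sum_add_distrib]
  map_smul' r a := by
    ext t
    by_cases hk : k = 0 <;> simp [hk, Finset.mul_sum]

/-- The simplicial homology `H_{k-1}(Δ)`, indexed by the number `k` of vertices: degree `n` is
`k = n + 1`, and for `k = 0` it is `H_{-1}(Δ) = 0`. -/
abbrev SimplicialHomology (Δ : PreAbstractSimplicialComplex X) (k : ℕ) : Type (max u v) :=
  Homology (C := fun k => SimplicialChains K Δ k) (simplicialBoundary K Δ) k

theorem chainIncl_boundary {Δ Δ' : PreAbstractSimplicialComplex X} (h : Δ ≤ Δ') (k : ℕ)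
    (c : SimplicialChains K Δ (k + 1)) :
    chainIncl K h k (simplicialBoundary K Δ k c) =
      simplicialBoundary K Δ' k (chainIncl K h (k + 1) c) := rfl

/-- The map on simplicial homology induced by an inclusion. -/
def simplicialHomologyIncl {Δ Δ' : PreAbstractSimplicialComplex X} (h : Δ ≤ Δ') (k : ℕ) :
    SimplicialHomology K Δ k →ₗ[K] SimplicialHomology K Δ' k :=
  homologyMap (C := fun k => SimplicialChains K Δ k) (D := fun k => SimplicialChains K Δ' k)
    (chainIncl K h) (chainIncl_boundary K h) k

end Simplicial

/-! ## Cellular cosheaves on a simplicial complex -/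

section Cosheaves

/-- A cellular cosheaf of `K`-vector spaces on the simplicial complex `N`: a contravariant functor
on the face poset of `N`. -/
structure Cosheaf (K : Type u) [Field K] {ι : Type w} (N : PreAbstractSimplicialComplex ι) where
  obj : N → Type v
  [addCommGroup : ∀ σ, AddCommGroup (obj σ)]
  [module : ∀ σ, Module K (obj σ)]
  map : ∀ {τ σ : N}, τ.1 ⊆ σ.1 → (obj σ →ₗ[K] obj τ)
  map_id : ∀ {σ : N} (h : σ.1 ⊆ σ.1) (y : obj σ), map h y = y
  map_comp : ∀ {ρ τ σ : N} (h : ρ.1 ⊆ τ.1) (h' : τ.1 ⊆ σ.1) (h'' : ρ.1 ⊆ σ.1) (y : obj σ),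
    map h'' y = map h (map h' y)

attribute [instance] Cosheaf.addCommGroup Cosheaf.module

variable {K : Type u} [Field K] {ι : Type w} {N : PreAbstractSimplicialComplex ι}

/-- A morphism of cosheaves. -/
structure CosheafHom (F : Cosheaf.{u, v} K N) (G : Cosheaf.{u, x} K N) where
  app : ∀ σ : N, F.obj σ →ₗ[K] G.obj σ
  naturality : ∀ {τ σ : N} (h : τ.1 ⊆ σ.1) (y : F.obj σ),
    app τ (F.map h y) = G.map h (app σ y)

/-- The `k`-simplices of `N`. -/
abbrev Simplices (N : PreAbstractSimplicialComplex ι) (k : ℕ) : Type w :=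
  {σ : N // σ.1.card = k + 1}

/-- `C_k F`, the direct sum of the data over the `k`-simplices (`N` is finite). -/
abbrev Cosheaf.Chains (F : Cosheaf.{u, v} K N) (k : ℕ) : Type (max v w) :=
  ∀ σ : Simplices N k, F.obj σ.1

/-- The map induced on chains by a morphism of cosheaves. -/
def CosheafHom.mapChains {F : Cosheaf.{u, v} K N} {G : Cosheaf.{u, x} K N} (f : CosheafHom F G)
    (k : ℕ) : F.Chains k →ₗ[K] G.Chains k :=
  LinearMap.pi fun σ => f.app σ.1 ∘ₗ LinearMap.proj σ

variable [Fintype ι] [LinearOrder ι]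

/-- The incidence number `[τ : σ]` of a face `τ` of codimension one of `σ`, for the orientation of
the simplices by the order of the vertices: `(-1)^r` if `τ` is `σ` without its vertex number `r`
(counted from `0`). -/
def incidence (τ σ : Finset ι) : ℤ :=
  ∏ a ∈ σ \ τ, (-1) ^ (σ.filter (· < a)).card

open Classical in
/-- The boundary map `C_{k+1} F → C_k F`, the sum of the maps `[τ : σ] F(τ ≤ σ)`. -/
def Cosheaf.boundary (F : Cosheaf.{u, v} K N) (k : ℕ) : F.Chains (k + 1) →ₗ[K] F.Chains k :=
  LinearMap.pi fun τ => ∑ σ : Simplices N (k + 1),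
    if h : τ.1.1 ⊆ σ.1.1 then incidence τ.1.1 σ.1.1 • (F.map h ∘ₗ LinearMap.proj σ) else 0

/-- The cosheaf homology `H_k(C_• F)`. -/
abbrev Cosheaf.H (F : Cosheaf.{u, v} K N) (k : ℕ) : Type (max v w) :=
  Homology F.boundary k

theorem CosheafHom.mapChains_boundary {F : Cosheaf.{u, v} K N} {G : Cosheaf.{u, x} K N}
    (f : CosheafHom F G) (k : ℕ) (c : F.Chains (k + 1)) :
    f.mapChains k (F.boundary k c) = G.boundary k (f.mapChains (k + 1) c) := by
  funext τ
  simp only [CosheafHom.mapChains, Cosheaf.boundary, LinearMap.pi_apply, LinearMap.comp_apply,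
    LinearMap.proj_apply, LinearMap.sum_apply, map_sum]
  refine Finset.sum_congr rfl fun σ _ => ?_
  by_cases h : τ.1.1 ⊆ σ.1.1
  · simp [h, f.naturality]
  · simp [h]

/-- The map `H_k(f)` induced on cosheaf homology by a morphism of cosheaves. -/
def CosheafHom.mapH {F : Cosheaf.{u, v} K N} {G : Cosheaf.{u, x} K N} (f : CosheafHom F G)
    (k : ℕ) : F.H k →ₗ[K] G.H k :=
  homologyMap f.mapChains f.mapChains_boundary k

end Cosheaves

/-! ## Rips complexes, covers and nerves -/

section Rips

variable {X : Type v} {ι : Type w}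

/-- The points indexed by the simplex `σ`: those lying in all `V i`, `i ∈ σ`. -/
def cell (V : ι → Set X) (σ : Finset ι) : Set X := ⋂ i ∈ σ, V i

theorem cell_anti (V : ι → Set X) {τ σ : Finset ι} (h : τ ⊆ σ) : cell V σ ⊆ cell V τ :=
  Set.biInter_subset_biInter_left h

/-- The nerve of the family `V`. -/
def nerve (V : ι → Set X) : PreAbstractSimplicialComplex ι where
  faces := {σ | σ.Nonempty ∧ (cell V σ).Nonempty}
  isRelLowerSet_faces := fun _ hs => ⟨hs.1, fun _ hts ht => ⟨ht, hs.2.mono (cell_anti V hts)⟩⟩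

variable [MetricSpace X]

/-- The Vietoris-Rips complex at parameter `ε` on the set `S` of points. -/
def rips (S : Set X) (ε : ℝ) : PreAbstractSimplicialComplex X where
  faces := {s | s.Nonempty ∧ (s : Set X) ⊆ S ∧ ∀ p ∈ s, ∀ q ∈ s, dist p q ≤ ε}
  isRelLowerSet_faces := fun _ hs => ⟨hs.1, fun _ hts ht =>
    ⟨ht, fun _ hp => hs.2.1 (hts hp), fun p hp q hq => hs.2.2 p (hts hp) q (hts hq)⟩⟩

theorem rips_mono {S T : Set X} {ε ε' : ℝ} (hS : S ⊆ T) (hε : ε ≤ ε') :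
    rips S ε ≤ rips T ε' :=
  fun _ hs => ⟨hs.1, hs.2.1.trans hS, fun p hp q hq => (hs.2.2 p hp q hq).trans hε⟩

/-- `K_p` for a point `p` that lies in `V i` only. -/
def singleRadius (V : ι → Set X) (i : ι) (p : X) : ℝ≥0∞ :=
  ⨅ (q : X) (_ : q ∉ V i), edist p q

/-- `K_p'` for a point `p` of `V i ∩ V j`. -/
def outerRadius (V : ι → Set X) (i j : ι) (p : X) : ℝ≥0∞ :=
  ⨅ (q : X) (_ : q ∉ V i ∪ V j), edist p q

/-- `K_p''` for a point `p` of `V i ∩ V j`. -/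
def crossRadius (V : ι → Set X) (i j : ι) (p : X) : ℝ≥0∞ :=
  ⨅ (q : X) (q' : X) (_ : edist p q < outerRadius V i j p ∧ q ∉ V i ∧
    edist p q' < outerRadius V i j p ∧ q' ∉ V j), edist q q'

/-- The bound `ε_*` of a cover with at most one-dimensional nerve: the minimum over all points `p`
of `K_p`, where `K_p` is `singleRadius` if `p` lies in exactly one element of the cover and
`min K_p' K_p''` if it lies in two. A minimum over the empty set is `∞`. -/
def epsStar (V : ι → Set X) : ℝ≥0∞ :=
  (⨅ (p : X) (i : ι) (_ : p ∈ V i ∧ ∀ j, p ∈ V j → j = i), singleRadius V i p) ⊓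
  (⨅ (p : X) (i : ι) (j : ι) (_ : i ≠ j ∧ p ∈ V i ∧ p ∈ V j),
    outerRadius V i j p ⊓ crossRadius V i j p)

end Rips

/-! ## The Leray cosheaves of the Rips system -/

section Leray

variable (K : Type u) [Field K] {X : Type v} [MetricSpace X] [Fintype X] {ι : Type w}
  (V : ι → Set X)

/-- The cosheaf `σ ↦ C_{k-1}(R_σ)` of simplicial chains on `k` vertices. -/
def chainCosheaf (ε : ℝ) (k : ℕ) : Cosheaf.{u, max u v} K (nerve V) where
  obj σ := SimplicialChains K (rips (cell V σ.1) ε) k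
  map h := chainIncl K (rips_mono (cell_anti V h) le_rfl) k
  map_id _ _ := rfl
  map_comp _ _ _ _ := rfl

/-- The cosheaf `F_{k-1} : σ ↦ H_{k-1}(R_σ)`, with the maps induced by inclusions (so that the
cosheaf of the homology in degree `n` is the one for `k = n + 1`, and for `k = 0` it is zero). -/
def lerayCosheaf (ε : ℝ) (k : ℕ) : Cosheaf.{u, max u v} K (nerve V) where
  obj σ := SimplicialHomology K (rips (cell V σ.1) ε) k
  map h := simplicialHomologyIncl K (rips_mono (cell_anti V h) le_rfl) k
  map_id _ y := by
    induction y using Submodule.Quotient.induction_on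
    rfl
  map_comp _ _ _ y := by
    induction y using Submodule.Quotient.induction_on
    rfl

/-- The simplicial boundary operators of all `R_σ`. -/
def chainBoundary (ε : ℝ) (k : ℕ) :
    CosheafHom (chainCosheaf K V ε (k + 1)) (chainCosheaf K V ε k) where
  app σ := simplicialBoundary K (rips (cell V σ.1) ε) k
  naturality _ _ := rfl

/-- The inclusions of the chains of `R_σ` at parameter `ε` into those at parameter `ε'`
(on chains: `ι` over the vertices and `κ` over the edges of the nerve). -/
def chainInclusion {ε ε' : ℝ} (h : ε ≤ ε') (k : ℕ) :
    CosheafHom (chainCosheaf K V ε k) (chainCosheaf K V ε' k) where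
  app _ := chainIncl K (rips_mono subset_rfl h) k
  naturality _ _ := rfl

/-- The cosheaf morphism `φ` induced by the inclusions of the `R_σ`. -/
def lerayMorphism {ε ε' : ℝ} (h : ε ≤ ε') (k : ℕ) :
    CosheafHom (lerayCosheaf K V ε k) (lerayCosheaf K V ε' k) where
  app _ := simplicialHomologyIncl K (rips_mono subset_rfl h) k
  naturality _ y := by
    induction y using Submodule.Quotient.induction_on
    rfl

/-- The families of cycles, one in each `R_σ` for `σ` a `j`-simplex of the nerve. -/
def cycleFamilies (ε : ℝ) (k j : ℕ) : Submodule K ((chainCosheaf K V ε k).Chains j) :=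
  Submodule.pi Set.univ fun σ =>
    cycles (C := fun k => SimplicialChains K (rips (cell V σ.1.1) ε) k)
      (simplicialBoundary K (rips (cell V σ.1.1) ε)) k

/-- The family `⟨c⟩` of homology classes of a family `c` of cycles. -/
def classFamily (ε : ℝ) (k j : ℕ) :
    cycleFamilies K V ε k j →ₗ[K] (lerayCosheaf K V ε k).Chains j :=
  LinearMap.pi fun σ =>
    homologyClass (C := fun k => SimplicialChains K (rips (cell V σ.1.1) ε) k)
      (simplicialBoundary K (rips (cell V σ.1.1) ε)) k ∘ₗ
      ((LinearMap.proj σ).restrict fun _ hc => hc σ (Set.mem_univ σ))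

variable [Fintype ι] [LinearOrder ι]

/-- `e : ⨁_e C_{k-1}(R_e) → ⨁_v C_{k-1}(R_v)`. -/
def edgeToVertex (ε : ℝ) (k : ℕ) :
    (chainCosheaf K V ε k).Chains 1 →ₗ[K] (chainCosheaf K V ε k).Chains 0 :=
  (chainCosheaf K V ε k).boundary 0

/-- The class `{⟨x⟩}` in `H_0(C_• F_{k-1})` of a family of cycles over the vertices. -/
def classH0 (ε : ℝ) (k : ℕ) :
    cycleFamilies K V ε k 0 →ₗ[K] (lerayCosheaf K V ε k).H 0 :=
  homologyClass (lerayCosheaf K V ε k).boundary 0 ∘ₗ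
    (classFamily K V ε k 0).codRestrict _ fun _ => Submodule.mem_top

/-- `c` represents the class `y` of `H_1(C_• F_{k-1})`: the family `⟨c⟩` over the edges is a cycle
of `C_• F_{k-1}`, and `y = {⟨c⟩}`. -/
def RepresentsH1 {ε : ℝ} {k : ℕ} (c : cycleFamilies K V ε k 1)
    (y : (lerayCosheaf K V ε k).H 1) : Prop :=
  ∃ h : classFamily K V ε k 1 c ∈ cycles (lerayCosheaf K V ε k).boundary 1,
    homologyClass (lerayCosheaf K V ε k).boundary 1 ⟨_, h⟩ = y

/-- `H_0(φ_n)`. -/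
abbrev mapH0 {ε ε' : ℝ} (h : ε ≤ ε') (n : ℕ) :
    (lerayCosheaf K V ε (n + 1)).H 0 →ₗ[K] (lerayCosheaf K V ε' (n + 1)).H 0 :=
  (lerayMorphism K V h (n + 1)).mapH 0

/-- `H_1(φ_{n-1})`. -/
abbrev mapH1 {ε ε' : ℝ} (h : ε ≤ ε') (n : ℕ) :
    (lerayCosheaf K V ε n).H 1 →ₗ[K] (lerayCosheaf K V ε' n).H 1 :=
  (lerayMorphism K V h n).mapH 1

/-- The choices made at one parameter `ε`, with next parameter `ε'`, for homology in degree `n`. -/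
structure StageChoice {ε ε' : ℝ} (h : ε ≤ ε') (n : ℕ) where
  /-- the complement `A` of `ker H_1(φ_{n-1})` -/
  A : Submodule K ((lerayCosheaf K V ε n).H 1)
  isCompl : IsCompl A (LinearMap.ker (mapH1 K V h n))
  /-- the size of the basis of `A` -/
  a : ℕ
  /-- the size of the basis of `ker H_1(φ_{n-1})` -/
  b : ℕ
  basisA : Module.Basis (Fin a) K A
  basisKer : Module.Basis (Fin b) K (LinearMap.ker (mapH1 K V h n))
  /-- the coset representatives `b^*` of the basis vectors -/
  rep : Fin a ⊕ Fin b → cycleFamilies K V ε n 1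
  rep_inl : ∀ r, RepresentsH1 K V (rep (Sum.inl r)) (basisA r : (lerayCosheaf K V ε n).H 1)
  rep_inr : ∀ r, RepresentsH1 K V (rep (Sum.inr r)) (basisKer r : (lerayCosheaf K V ε n).H 1)
  /-- the set map `Γ`, with `∂ Γ = e b^*` -/
  Gam : Fin a ⊕ Fin b → (chainCosheaf K V ε (n + 1)).Chains 0
  boundary_Gam : ∀ r, (chainBoundary K V ε n).mapChains 0 (Gam r) =
    edgeToVertex K V ε n (rep r).1
  /-- the elements `α` at the next parameter, with `∂ α = κ b^*` -/
  alpha : Fin b → (chainCosheaf K V ε' (n + 1)).Chains 1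
  boundary_alpha : ∀ r, (chainBoundary K V ε' n).mapChains 1 (alpha r) =
    (chainInclusion K V h n).mapChains 1 (rep (Sum.inr r)).1

namespace StageChoice

variable {K V} {ε ε' : ℝ} {h : ε ≤ ε'} {n : ℕ} (S : StageChoice K V h n)

/-- The basis of `H_1(C_• F_{n-1})` that is the union of those of `A` and `ker H_1(φ_{n-1})`. -/
def basis : Module.Basis (Fin S.a ⊕ Fin S.b) K ((lerayCosheaf K V ε n).H 1) :=
  (S.basisA.prod S.basisKer).map (Submodule.prodEquivOfIsCompl _ _ S.isCompl)

theorem delta_mem (r : Fin S.b) :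
    -edgeToVertex K V ε' (n + 1) (S.alpha r) +
        (chainInclusion K V h (n + 1)).mapChains 0 (S.Gam (Sum.inr r)) ∈
      cycleFamilies K V ε' (n + 1) 0 := by
  have key : (chainBoundary K V ε' n).mapChains 0
      (-edgeToVertex K V ε' (n + 1) (S.alpha r) +
        (chainInclusion K V h (n + 1)).mapChains 0 (S.Gam (Sum.inr r))) = 0 := by
    have h1 : (chainBoundary K V ε' n).mapChains 0
        (edgeToVertex K V ε' (n + 1) (S.alpha r)) =
        edgeToVertex K V ε' n ((chainInclusion K V h n).mapChains 1 (S.rep (Sum.inr r)).1) := by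
      rw [← S.boundary_alpha r]
      exact CosheafHom.mapChains_boundary _ 0 _
    have h2 : (chainBoundary K V ε' n).mapChains 0
        ((chainInclusion K V h (n + 1)).mapChains 0 (S.Gam (Sum.inr r))) =
        (chainInclusion K V h n).mapChains 0 (edgeToVertex K V ε n (S.rep (Sum.inr r)).1) := by
      rw [← S.boundary_Gam (Sum.inr r)]
      rfl
    have h3 : (chainInclusion K V h n).mapChains 0
        (edgeToVertex K V ε n (S.rep (Sum.inr r)).1) =
        edgeToVertex K V ε' n ((chainInclusion K V h n).mapChains 1 (S.rep (Sum.inr r)).1) :=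
      CosheafHom.mapChains_boundary _ 0 _
    rw [map_add, map_neg, h1, h2, h3, neg_add_cancel]
  intro σ _
  exact congrFun key σ

/-- `δ : ker H_1(φ_{n-1}) → H_0(C_• F_n)` at the next parameter, the linear map that sends the
basis vector `{⟨b⟩}` to `{⟨- e α + ι Γ{⟨b⟩}⟩}`. -/
def delta : LinearMap.ker (mapH1 K V h n) →ₗ[K] (lerayCosheaf K V ε' (n + 1)).H 0 :=
  S.basisKer.constr K fun r => classH0 K V ε' (n + 1) ⟨_, S.delta_mem r⟩

/-- `ψ`, the extension of `δ` by zero on `A`. -/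
def psi : (lerayCosheaf K V ε n).H 1 →ₗ[K] (lerayCosheaf K V ε' (n + 1)).H 0 :=
  S.delta ∘ₗ Submodule.projectionOnto (LinearMap.ker (mapH1 K V h n)) S.A S.isCompl.symm

/-- `Ψ({⟨x⟩}, {⟨y⟩}) = (H_0(φ_n){⟨x⟩} + (-1)^(n+1) ψ{⟨y⟩}, H_1(φ_{n-1}){⟨y⟩})`. -/
def Psi : ((lerayCosheaf K V ε (n + 1)).H 0 × (lerayCosheaf K V ε n).H 1) →ₗ[K]
    ((lerayCosheaf K V ε' (n + 1)).H 0 × (lerayCosheaf K V ε' n).H 1) :=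
  (mapH0 K V h n ∘ₗ LinearMap.fst K _ _ + ((-1 : K) ^ (n + 1)) • (S.psi ∘ₗ LinearMap.snd K _ _)).prod
    (mapH1 K V h n ∘ₗ LinearMap.snd K _ _)

/-- The choices `S'` at the parameter `ε'` are obtained from the choices `S` at the previous
parameter `ε` by the inductive step: there are a basis `C` of `H_1` at `ε'` extending the images of
the basis vectors of `A`, and representatives `c^*` and chains `Γ_C` for it, those of the images
being the images of the ones of `S`, such that the representatives `b^*` and the map `Γ` of `S'`
are the linear combinations of the `c^*` and of `Γ_C` with the coordinates in the basis `C`. -/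
def Follows {ε'' : ℝ} {h' : ε' ≤ ε''} (S : StageChoice K V h n) (S' : StageChoice K V h' n) :
    Prop :=
  ∃ (d : ℕ) (C : Module.Basis (Fin S.a ⊕ Fin d) K ((lerayCosheaf K V ε' n).H 1))
    (crep : Fin S.a ⊕ Fin d → cycleFamilies K V ε' n 1)
    (GamC : Fin S.a ⊕ Fin d → (chainCosheaf K V ε' (n + 1)).Chains 0),
    (∀ r, C (Sum.inl r) = mapH1 K V h n (S.basisA r)) ∧
    (∀ r, (crep (Sum.inl r)).1 = (chainInclusion K V h n).mapChains 1 (S.rep (Sum.inl r)).1) ∧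
    (∀ r, GamC (Sum.inl r) = (chainInclusion K V h (n + 1)).mapChains 0 (S.Gam (Sum.inl r))) ∧
    (∀ r, RepresentsH1 K V (crep (Sum.inr r)) (C (Sum.inr r))) ∧
    (∀ r, (chainBoundary K V ε' n).mapChains 0 (GamC (Sum.inr r)) =
      edgeToVertex K V ε' n (crep (Sum.inr r)).1) ∧
    (∀ r, S'.rep r = ∑ s, C.repr (S'.basis r) s • crep s) ∧
    (∀ r, S'.Gam r = ∑ s, C.repr (S'.basis r) s • GamC s)

end StageChoice

end Leray

/-! ## Persistence modules -/

section Persistence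

/-- A persistence module: a finite sequence `obj 0 → obj 1 → ⋯ → obj N` of vector spaces and
linear maps. -/
structure PersistenceModule (K : Type u) [Field K] (N : ℕ) where
  obj : Fin (N + 1) → Type v
  [addCommGroup : ∀ i, AddCommGroup (obj i)]
  [module : ∀ i, Module K (obj i)]
  map : ∀ i : Fin N, obj i.castSucc →ₗ[K] obj i.succ

attribute [instance] PersistenceModule.addCommGroup PersistenceModule.module

/-- Two persistence modules are isomorphic: there are linear isomorphisms that commute with the
structure maps. -/
def PersistenceModule.Isomorphic {K : Type u} [Field K] {N : ℕ}
    (M : PersistenceModule.{u, v} K N) (M' : PersistenceModule.{u, w} K N) : Prop :=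
  ∃ e : ∀ i, M.obj i ≃ₗ[K] M'.obj i,
    ∀ (i : Fin N) (y : M.obj i.castSucc), e i.succ (M.map i y) = M'.map i (e i.castSucc y)

variable (K : Type u) [Field K] {X : Type v} [MetricSpace X] [Fintype X]

/-- The persistence module `H_n(R^0) → H_n(R^1) → ⋯ → H_n(R^N)` of the Rips complexes on all
points. -/
def ripsModule (n : ℕ) {N : ℕ} (ε : Fin (N + 1) → ℝ) (hε : Monotone ε) :
    PersistenceModule K N where
  obj i := SimplicialHomology K (rips (Set.univ : Set X) (ε i)) (n + 1)
  map i := simplicialHomologyIncl K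
    (rips_mono subset_rfl (hε (Fin.castSucc_lt_succ (i := i)).le)) (n + 1)

variable {ι : Type w} [Fintype ι] [LinearOrder ι] (V : ι → Set X)

/-- Consistent choices for all parameters: choices at every parameter but the last one, arbitrary
at the first parameter and then made by the inductive step. -/
structure ConsistentChoice (n : ℕ) {N : ℕ} (ε : Fin (N + 1) → ℝ) (hε : Monotone ε) where
  stage : ∀ i : Fin N, StageChoice K V (hε (Fin.castSucc_lt_succ (i := i)).le) n
  follows : ∀ (i : ℕ) (hi : i + 1 < N),
    StageChoice.Follows (stage ⟨i, Nat.lt_of_succ_lt hi⟩) (stage ⟨i + 1, hi⟩)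

/-- The persistence module `V_Ψ` with spaces `H_0(C_• F^i_n) ⊕ H_1(C_• F^i_{n-1})` and maps
`Ψ^i`. -/
def psiModule {n N : ℕ} {ε : Fin (N + 1) → ℝ} {hε : Monotone ε}
    (S : ConsistentChoice K V n ε hε) : PersistenceModule K N where
  obj i := (lerayCosheaf K V (ε i) (n + 1)).H 0 × (lerayCosheaf K V (ε i) n).H 1
  map i := (S.stage i).Psi

end Persistence

end DistPH

end

/-! Write R for the Rips complex on all points. Below `epsStar` every simplex of R lies in a single
V_i (`exists_subset_of_mem_rips`), and since the nerve has dimension at most one it lies in at most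
two of them. Hence the sequence of chains 0 → ⨁_e C(R_e) → ⨁_v C(R_v) → C(R) → 0 is exact
(`edgeToVertex_injective`, `exists_edgeToVertex_eq`, `vertexSum_surjective`). Its Mayer-Vietoris
sequence breaks up into 0 → H_0(F_n) → H_n(R) → H_1(F_{n-1}) → 0. Here the first map is induced by
summing over the vertices, and a class represented by c is hit by the sum of any family Γ with ∂Γ =
e c. Choosing such lifts on a basis gives a linear section s, and (x, y) ↦ sum(x) ± s(y) is an
isomorphism (`sectionMap_injective`, `sectionMap_surjective`). Of the sign it matters only that it
is non-zero and the same at all parameters.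

These splittings are not natural in the parameter. Commutation with Ψ amounts to sum ∘ ψ + s' ∘
H_1(φ) = incl ∘ s (`sectionMap_Psi`). On the kernel of H_1(φ) the middle term vanishes, and δ is
designed to give the right side, because the sum over the vertices kills e α (`sumH0_delta`). On A
the map ψ is zero, and s' has to agree with s pushed forward; this is what the consistency of the
choices provides (`StageChoice.Follows.toSection_basisA`).

Chain indices count vertices: degree n is index `n + 1`, and index `0` is degree -1, where all
chains vanish. -/

noncomputable section

namespace DistPH

universe u v w

/-! ## The bound of a cover -/

section Bound

variable {X : Type v} [MetricSpace X] {ι : Type w} {V : ι → Set X}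

/-- In a finite metric space distinct points have distance bounded below. -/
theorem exists_pos_le_edist (X : Type v) [MetricSpace X] [Finite X] :
    ∃ r : ℝ≥0∞, 0 < r ∧ ∀ p q : X, p ≠ q → r ≤ edist p q := by
  by_cases h : Nonempty {a : X × X // a.1 ≠ a.2}
  · obtain ⟨a, ha⟩ := Finite.exists_min fun a : {a : X × X // a.1 ≠ a.2} => edist a.1.1 a.1.2
    exact ⟨_, edist_pos.2 a.2, fun p q hpq => ha ⟨(p, q), hpq⟩⟩
  · exact ⟨1, one_pos, fun p q hpq => (h ⟨⟨(p, q), hpq⟩⟩).elim⟩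

/-- All the minima involved are over distances between distinct points. For `crossRadius`, a common
point q = q' would lie outside V_i ∪ V_j and yet be closer to p than `outerRadius`. -/
theorem epsStar_pos [Finite X] (V : ι → Set X) : 0 < epsStar V := by
  obtain ⟨r, hr, hle⟩ := exists_pos_le_edist X
  refine hr.trans_le (le_inf ?_ ?_)
  · refine le_iInf fun p => le_iInf fun i => le_iInf fun hp => le_iInf fun q => le_iInf fun hq => ?_
    exact hle _ _ fun h => hq (h ▸ hp.1)
  · refine le_iInf fun p => le_iInf fun i => le_iInf fun j => le_iInf fun hp => le_inf ?_ ?_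
    · refine le_iInf fun q => le_iInf fun hq => hle _ _ fun h => hq (h ▸ Or.inl hp.2.1)
    · refine le_iInf fun q => le_iInf fun q' => le_iInf fun ⟨h1, h2, h3, h4⟩ => hle _ _ ?_
      rintro rfl
      refine absurd h1 (not_lt.2 ?_)
      exact iInf₂_le q fun h => h.elim h2 h4

/-- Below the bound, every simplex of the Rips complex lies in one element of the cover. -/
theorem exists_subset_of_mem_rips (hcover : ⋃ i, V i = Set.univ) {ε : ℝ}
    (hε : ENNReal.ofReal ε < epsStar V) {s : Finset X} (hs : s ∈ rips (Set.univ : Set X) ε) :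
    ∃ i, (s : Set X) ⊆ V i := by
  obtain ⟨⟨p, hp⟩, -, hd⟩ := hs
  have hd' : ∀ q ∈ s, ∀ q' ∈ s, edist q q' ≤ ENNReal.ofReal ε := fun q hq q' hq' => by
    rw [edist_dist]
    exact ENNReal.ofReal_le_ofReal (hd q hq q' hq')
  obtain ⟨i, hi⟩ := Set.mem_iUnion.1 (hcover.symm ▸ Set.mem_univ p : p ∈ ⋃ i, V i)
  -- One vertex p of the simplex decides which of V_i, V_j have to be considered.
  by_cases h : ∀ j, p ∈ V j → j = i
  · refine ⟨i, fun q hq => by_contra fun hqi => ?_⟩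
    have : epsStar V ≤ edist p q := inf_le_left.trans
      ((iInf_le _ p).trans ((iInf₂_le i ⟨hi, h⟩).trans (iInf₂_le q hqi)))
    exact absurd (hε.trans_le this) (not_lt.2 (hd' p hp q hq))
  · push Not at h
    obtain ⟨j, hj, hji⟩ := h
    have hle : epsStar V ≤ outerRadius V i j p ⊓ crossRadius V i j p := inf_le_right.trans
      ((iInf_le _ p).trans ((iInf_le _ i).trans (iInf₂_le j ⟨hji.symm, hi, hj⟩)))
    -- All vertices are within `outerRadius` of p, so points q, q' of the simplex outside V_i and
    -- V_j form an admissible pair for `crossRadius`.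
    have hout : ∀ q ∈ s, edist p q < outerRadius V i j p := fun q hq =>
      (hd' p hp q hq).trans_lt (hε.trans_le (hle.trans inf_le_left))
    by_contra hno
    push Not at hno
    obtain ⟨q, hq, hqi⟩ := Set.not_subset.1 (hno i)
    obtain ⟨q', hq', hqj⟩ := Set.not_subset.1 (hno j)
    have : epsStar V ≤ edist q q' := (hle.trans inf_le_right).trans
      ((iInf_le _ q).trans (iInf₂_le q' ⟨hout q hq, hqi, hout q' hq', hqj⟩))
    exact absurd (hε.trans_le this) (not_lt.2 (hd' q hq q' hq'))

end Bound

/-! ## The simplices of a one-dimensional nerve -/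

section Nerve

variable {X : Type v} {ι : Type w} {V : ι → Set X}

/-- The vertex `i` of the nerve. -/
def nerveVertex (i : ι) (h : (V i).Nonempty) : Simplices (nerve V) 0 :=
  ⟨⟨{i}, Finset.singleton_nonempty i, by simpa [cell] using h⟩, by simp⟩

theorem cell_nerveVertex (i : ι) (h : (V i).Nonempty) : cell V (nerveVertex i h).1.1 = V i := by
  simp [cell, nerveVertex]

theorem cell_union [DecidableEq ι] (V : ι → Set X) (σ τ : Finset ι) :
    cell V (σ ∪ τ) = cell V σ ∩ cell V τ := by
  ext p
  simp only [cell, Set.mem_iInter, Set.mem_inter_iff, Finset.mem_union]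
  exact ⟨fun h => ⟨fun i hi => h i (Or.inl hi), fun i hi => h i (Or.inr hi)⟩,
    fun h i hi => hi.elim (h.1 i) (h.2 i)⟩

/-- Two edges of a one-dimensional nerve with a common vertex and a common point are equal. -/
theorem Simplices.edge_eq [DecidableEq ι] (hN : ∀ σ ∈ nerve V, σ.card ≤ 2)
    {σ τ : Simplices (nerve V) 1} {p : X} (hσ : p ∈ cell V σ.1.1) (hτ : p ∈ cell V τ.1.1) :
    σ = τ := by
  have h := hN (σ.1.1 ∪ τ.1.1) ⟨σ.1.2.1.mono Finset.subset_union_left, p, by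
    rw [cell_union]; exact ⟨hσ, hτ⟩⟩
  have h1 : σ.1.1 = σ.1.1 ∪ τ.1.1 :=
    Finset.eq_of_subset_of_card_le Finset.subset_union_left (by rw [σ.2]; exact h)
  have h2 : τ.1.1 = σ.1.1 ∪ τ.1.1 :=
    Finset.eq_of_subset_of_card_le Finset.subset_union_right (by rw [τ.2]; exact h)
  exact Subtype.ext (Subtype.ext (h1.trans h2.symm))

/-- A vertex whose cell meets the cell of an edge of a one-dimensional nerve is on the edge. -/
theorem Simplices.vertex_subset_edge [DecidableEq ι] (hN : ∀ σ ∈ nerve V, σ.card ≤ 2)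
    {v : Simplices (nerve V) 0} {σ : Simplices (nerve V) 1} {p : X} (hv : p ∈ cell V v.1.1)
    (hσ : p ∈ cell V σ.1.1) : v.1.1 ⊆ σ.1.1 := by
  have h := hN (σ.1.1 ∪ v.1.1) ⟨σ.1.2.1.mono Finset.subset_union_left, p, by
    rw [cell_union]; exact ⟨hσ, hv⟩⟩
  have h1 : σ.1.1 = σ.1.1 ∪ v.1.1 :=
    Finset.eq_of_subset_of_card_le Finset.subset_union_left (by rw [σ.2]; exact h)
  rw [h1]
  exact Finset.subset_union_right

/-- Two distinct vertices with a common point span an edge. -/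
theorem Simplices.exists_edge [DecidableEq ι]
    {v w : Simplices (nerve V) 0} (hvw : v ≠ w) {s : Set X} (hs : s.Nonempty)
    (hv : s ⊆ cell V v.1.1) (hw : s ⊆ cell V w.1.1) :
    ∃ σ : Simplices (nerve V) 1, s ⊆ cell V σ.1.1 := by
  have hsub : s ⊆ cell V (v.1.1 ∪ w.1.1) := by
    rw [cell_union]; exact Set.subset_inter hv hw
  refine ⟨⟨⟨v.1.1 ∪ w.1.1, v.1.2.1.mono Finset.subset_union_left, hs.mono hsub⟩, ?_⟩, hsub⟩
  obtain ⟨a, ha⟩ := Finset.card_eq_one.1 v.2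
  obtain ⟨b, hb⟩ := Finset.card_eq_one.1 w.2
  have hab : a ≠ b := by
    rintro rfl
    exact hvw (Subtype.ext (Subtype.ext (ha.trans hb.symm)))
  change (v.1.1 ∪ w.1.1).card = 2
  rw [ha, hb]
  exact Finset.card_pair hab

/-- The two end points of an edge, with the incidence numbers. -/
theorem Simplices.exists_vertices [LinearOrder ι] (σ : Simplices (nerve V) 1) :
    ∃ v w : Simplices (nerve V) 0, v ≠ w ∧ v.1.1 ⊆ σ.1.1 ∧ w.1.1 ⊆ σ.1.1 ∧
      incidence v.1.1 σ.1.1 = -1 ∧ incidence w.1.1 σ.1.1 = 1 ∧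
      ∀ x : Simplices (nerve V) 0, x.1.1 ⊆ σ.1.1 → x = v ∨ x = w := by
  obtain ⟨⟨σ, hne, hc⟩, hσ⟩ := σ
  have key : ∃ a b : ι, a < b ∧ σ = {a, b} := by
    obtain ⟨a, b, hab, rfl⟩ := Finset.card_eq_two.1 hσ
    rcases lt_or_gt_of_ne hab with h | h
    · exact ⟨a, b, h, rfl⟩
    · exact ⟨b, a, h, Finset.pair_comm a b⟩
  obtain ⟨a, b, hab, rfl⟩ := key
  have ha : (V a).Nonempty := hc.mono fun p hp => Set.mem_iInter₂.1 hp a (by simp)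
  have hb : (V b).Nonempty := hc.mono fun p hp => Set.mem_iInter₂.1 hp b (by simp)
  refine ⟨nerveVertex a ha, nerveVertex b hb, ?_, by simp [nerveVertex], by simp [nerveVertex],
    ?_, ?_, ?_⟩
  · intro h
    have : ({a} : Finset ι) = {b} := congrArg (fun v => v.1.1) h
    exact hab.ne (Finset.singleton_injective this)
  · have h1 : ({a, b} : Finset ι) \ {a} = {b} := by
      ext x; simp only [Finset.mem_sdiff, Finset.mem_insert, Finset.mem_singleton]
      grind
    have h2 : ({a, b} : Finset ι).filter (· < b) = {a} := by
      ext x; simp only [Finset.mem_filter, Finset.mem_insert, Finset.mem_singleton]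
      grind
    simp [incidence, nerveVertex, h1, h2]
  · have h1 : ({a, b} : Finset ι) \ {b} = {a} := by
      ext x; simp only [Finset.mem_sdiff, Finset.mem_insert, Finset.mem_singleton]
      grind
    have h2 : ({a, b} : Finset ι).filter (· < a) = ∅ := by
      ext x; simp only [Finset.mem_filter, Finset.mem_insert, Finset.mem_singleton]
      grind
    simp [incidence, nerveVertex, h1, h2]
  · intro x hx
    obtain ⟨d, hd⟩ := Finset.card_eq_one.1 x.2
    rw [hd] at hx
    have : d = a ∨ d = b := by simpa using hx
    refine this.imp ?_ ?_
    · rintro rfl; exact Subtype.ext (Subtype.ext hd)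
    · rintro rfl; exact Subtype.ext (Subtype.ext hd)

theorem isEmpty_simplices_two (hN : ∀ σ ∈ nerve V, σ.card ≤ 2) :
    IsEmpty (Simplices (nerve V) 2) :=
  ⟨fun σ => by have := hN _ σ.1.2; have := σ.2; omega⟩

end Nerve

/-! ## The Mayer-Vietoris sequence of chains -/

section MayerVietoris

variable {K : Type u} [Field K] {X : Type v}

/-- Simplices are non-empty, so the empty tuple spans none. -/
theorem simplicialChains_zero {Δ : PreAbstractSimplicialComplex X} (c : SimplicialChains K Δ 0) :
    c = 0 := by
  refine Subtype.ext (funext fun t => by_contra fun ht => ?_)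
  obtain ⟨-, s, hs, hst⟩ := c.2.2 t ht
  obtain ⟨p, hp⟩ := (Δ.isRelLowerSet_faces hs).1
  have : p ∈ Set.range t := hst ▸ hp
  obtain ⟨a, -⟩ := this
  exact a.elim0

variable [MetricSpace X]

theorem SimplicialChains.range_subset {S : Set X} {ε : ℝ} {k : ℕ}
    (c : SimplicialChains K (rips S ε) k) {t : Fin k → X} (ht : c.1 t ≠ 0) : Set.range t ⊆ S := by
  obtain ⟨-, s, hs, hst⟩ := c.2.2 t ht
  exact hst ▸ hs.2.1

open Classical in
/-- The part of a chain on the simplices with the property `p`, which all lie in `T`. -/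
def filterChain {S : Set X} {ε : ℝ} {k : ℕ} (p : Set X → Prop) (T : Set X)
    (hp : ∀ s, p s → s ⊆ T) (c : SimplicialChains K (rips S ε) k) :
    SimplicialChains K (rips T ε) k :=
  ⟨fun t => if p (Set.range t) then c.1 t else 0, by
    refine ⟨fun t σ => ?_, fun t ht => ?_⟩
    -- The condition sees only the set of entries, hence is invariant under permutations.
    · simp only [EquivLike.range_comp, c.2.1]
      split_ifs <;> simp
    · dsimp only at ht
      split_ifs at ht with h
      · obtain ⟨hinj, s, hs, hst⟩ := c.2.2 t ht
        exact ⟨hinj, s, ⟨hs.1, hst ▸ hp _ h, hs.2.2⟩, hst⟩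
      · exact (ht rfl).elim⟩

theorem filterChain_apply_eq_zero {S : Set X} {ε : ℝ} {k : ℕ} (p : Set X → Prop) (T : Set X)
    (hp : ∀ s, p s → s ⊆ T) (c : SimplicialChains K (rips S ε) k) {t : Fin k → X}
    (ht : c.1 t = 0) : (filterChain p T hp c).1 t = 0 := by
  simp [filterChain, ht]

variable {ι : Type w} {V : ι → Set X}

/-- The chain of the simplex `σ` of the nerve as a function of tuples of points. -/
def chainVal (ε : ℝ) (k : ℕ) (σ : nerve V) :
    (chainCosheaf K V ε k).obj σ →ₗ[K] ((Fin k → X) → K) :=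
  (SimplicialChains K (rips (cell V σ.1) ε) k).subtype

theorem chainVal_injective (ε : ℝ) (k : ℕ) (σ : nerve V) :
    Function.Injective (chainVal (K := K) ε k σ) :=
  Subtype.val_injective

theorem chainVal_range {ε : ℝ} {k : ℕ} {σ : nerve V} (c : (chainCosheaf K V ε k).obj σ)
    {t : Fin k → X} (ht : chainVal ε k σ c t ≠ 0) : Set.range t ⊆ cell V σ.1 :=
  SimplicialChains.range_subset (K := K) (S := cell V σ.1) (ε := ε) c ht

/-- The part of a chain over `σ` that lies over `τ`. -/
def restrictChain (ε : ℝ) (k : ℕ) (σ τ : nerve V) (c : (chainCosheaf K V ε k).obj σ) :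
    (chainCosheaf K V ε k).obj τ :=
  filterChain (K := K) (S := cell V σ.1) (ε := ε) (k := k) (fun s => s ⊆ cell V τ.1)
    (cell V τ.1) (fun _ h => h) c

theorem chainVal_restrictChain {ε : ℝ} {k : ℕ} {σ τ : nerve V}
    (c : (chainCosheaf K V ε k).obj σ) {t : Fin k → X} (ht : Set.range t ⊆ cell V τ.1) :
    chainVal ε k τ (restrictChain ε k σ τ c) t = chainVal ε k σ c t :=
  if_pos ht

/-- The inclusion `C_{k-1}(R_σ) → C_{k-1}(R)`. -/
def chainToTotal (ε : ℝ) (k : ℕ) (σ : nerve V) :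
    (chainCosheaf K V ε k).obj σ →ₗ[K] SimplicialChains K (rips (Set.univ : Set X) ε) k :=
  chainIncl K (rips_mono (Set.subset_univ (cell V σ.1)) (le_refl ε)) k

variable [Fintype ι]

open Classical in
/-- The sum `⨁_v C_{k-1}(R_v) → C_{k-1}(R)` of the inclusions. -/
def vertexSum (K : Type u) [Field K] (V : ι → Set X) (ε : ℝ) (k : ℕ) :
    (chainCosheaf K V ε k).Chains 0 →ₗ[K]
      SimplicialChains K (rips (Set.univ : Set X) ε) k :=
  ∑ v : Simplices (nerve V) 0, chainToTotal ε k v.1 ∘ₗ LinearMap.proj v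

open Classical in
theorem vertexSum_apply (ε : ℝ) (k : ℕ) (c : (chainCosheaf K V ε k).Chains 0) (t : Fin k → X) :
    (vertexSum K V ε k c).1 t =
      ∑ v : Simplices (nerve V) 0, chainVal ε k v.1 (c v) t := by
  simp only [vertexSum, LinearMap.sum_apply, Submodule.coe_sum, Finset.sum_apply]
  rfl

theorem vertexSum_chainInclusion {ε ε' : ℝ} (h : ε ≤ ε') (k : ℕ)
    (c : (chainCosheaf K V ε k).Chains 0) :
    vertexSum K V ε' k ((chainInclusion K V h k).mapChains 0 c) =
      chainIncl K (rips_mono subset_rfl h) k (vertexSum K V ε k c) := by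
  simp only [vertexSum, LinearMap.sum_apply, map_sum]
  rfl

/-- Each simplex is assigned to one vertex of the nerve whose cell contains it, and the chain is
split accordingly. -/
theorem vertexSum_surjective {ε : ℝ}
    (hR : ∀ s ∈ rips (Set.univ : Set X) ε, ∃ i, (s : Set X) ⊆ V i) (k : ℕ) :
    Function.Surjective (vertexSum K V ε k) := by
  classical
  intro z
  -- The value `none` serves sets that are not simplices; the nerve may have no vertex at all.
  have hf : ∀ s : Set X, ∃ v : Option (Simplices (nerve V) 0),
      (∃ s' ∈ rips (Set.univ : Set X) ε, (s' : Set X) = s) → ∃ w, v = some w ∧ s ⊆ cell V w.1.1 := by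
    intro s
    by_cases h : ∃ s' ∈ rips (Set.univ : Set X) ε, (s' : Set X) = s
    · obtain ⟨s', hs', rfl⟩ := h
      obtain ⟨i, hi⟩ := hR s' hs'
      have hne : (V i).Nonempty := (Finset.coe_nonempty.2 hs'.1).mono hi
      exact ⟨some (nerveVertex i hne), fun _ => ⟨_, rfl, by rwa [cell_nerveVertex]⟩⟩
    · exact ⟨none, fun h' => (h h').elim⟩
  choose f hf using hf
  refine ⟨fun v => filterChain (fun s => f s = some v ∧ s ⊆ cell V v.1.1) (cell V v.1.1)
    (fun s hs => hs.2) z, Subtype.ext (funext fun t => ?_)⟩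
  refine (vertexSum_apply _ _ _ _).trans ?_
  by_cases ht : z.1 t = 0
  · rw [ht]
    exact Finset.sum_eq_zero fun v _ => filterChain_apply_eq_zero
      (fun s => f s = some v ∧ s ⊆ cell V v.1.1) (cell V v.1.1) (fun s hs => hs.2) z ht
  · obtain ⟨w, hw, hsub⟩ := hf (Set.range t) (z.2.2 t ht).2
    refine (Finset.sum_eq_single w (fun v _ hv => ?_) (by simp)).trans (if_pos ⟨hw, hsub⟩)
    exact if_neg fun h => hv (Option.some_injective _ (h.1.symm.trans hw))

variable [LinearOrder ι]

open Classical in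
theorem chainVal_edgeToVertex (ε : ℝ) (k : ℕ) (c : (chainCosheaf K V ε k).Chains 1)
    (v : Simplices (nerve V) 0) (t : Fin k → X) :
    chainVal ε k v.1 (edgeToVertex K V ε k c v) t =
      ∑ σ : Simplices (nerve V) 1, if v.1.1 ⊆ σ.1.1 then
        (incidence v.1.1 σ.1.1 : K) * chainVal ε k σ.1 (c σ) t else 0 := by
  simp only [edgeToVertex, Cosheaf.boundary, LinearMap.pi_apply, LinearMap.sum_apply, map_sum,
    Finset.sum_apply]
  refine Finset.sum_congr rfl fun σ _ => ?_
  split_ifs with h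
  · rw [LinearMap.smul_apply, map_zsmul, Pi.smul_apply, zsmul_eq_mul]
    rfl
  · simp

/-- Each edge contributes to its two ends with opposite incidence numbers. -/
theorem vertexSum_edgeToVertex (ε : ℝ) (k : ℕ) (c : (chainCosheaf K V ε k).Chains 1) :
    vertexSum K V ε k (edgeToVertex K V ε k c) = 0 := by
  classical
  refine Subtype.ext (funext fun t => ?_)
  rw [vertexSum_apply]
  simp only [chainVal_edgeToVertex]
  rw [Finset.sum_comm]
  refine Finset.sum_eq_zero fun σ _ => ?_
  obtain ⟨v, w, hvw, hv, hw, hiv, hiw, hall⟩ := σ.exists_vertices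
  rw [Finset.sum_eq_add v w hvw (fun x _ hx => if_neg fun h => (hall x h).elim hx.1 hx.2)
    (by simp) (by simp), if_pos hv, if_pos hw, hiv, hiw]
  simp

open Classical in
/-- The value of `e c` at a tuple in the cell of an edge. -/
theorem chainVal_edgeToVertex_of_subset (hN : ∀ σ ∈ nerve V, σ.card ≤ 2) {ε : ℝ} {k : ℕ}
    (c : (chainCosheaf K V ε (k + 1)).Chains 1) {v : Simplices (nerve V) 0}
    {σ : Simplices (nerve V) 1} (hv : v.1.1 ⊆ σ.1.1) {t : Fin (k + 1) → X}
    (ht : Set.range t ⊆ cell V σ.1.1) :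
    chainVal ε (k + 1) v.1 (edgeToVertex K V ε (k + 1) c v) t =
      (incidence v.1.1 σ.1.1 : K) * chainVal ε (k + 1) σ.1 (c σ) t := by
  rw [chainVal_edgeToVertex, Finset.sum_eq_single σ, if_pos hv]
  · intro τ _ hτ
    split_ifs with h
    -- The tuple has `k + 1` entries, so it has a first point, which would lie in the cells of two
    -- different edges.
    · by_contra hne
      exact hτ (Simplices.edge_eq hN (chainVal_range _ (right_ne_zero_of_mul hne) ⟨0, rfl⟩)
        (ht ⟨0, rfl⟩))
    · rfl
  · simp

/-- On the cell of an edge no other edge contributes to `e c`, so `c` can be read off there at an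
end of the edge. -/
theorem edgeToVertex_injective (hN : ∀ σ ∈ nerve V, σ.card ≤ 2) (ε : ℝ) (k : ℕ) :
    Function.Injective (edgeToVertex K V ε k) := by
  classical
  rw [injective_iff_map_eq_zero]
  intro c hc
  funext σ
  cases k with
  | zero => exact simplicialChains_zero (K := K) _
  | succ k =>
    refine chainVal_injective ε (k + 1) σ.1 (funext fun t => ?_)
    by_contra hne
    rw [Pi.zero_apply, map_zero] at hne
    obtain ⟨v, w, hvw, hv, hw, hiv, hiw, hall⟩ := σ.exists_vertices
    have h := chainVal_edgeToVertex_of_subset hN c hw (chainVal_range _ hne)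
    rw [hc, hiw, Int.cast_one, one_mul] at h
    rw [← h] at hne
    simp at hne

/-- Exactness in the middle. The preimage puts on each edge the part of `c` at the end with
incidence number 1; the other end then fits because the two values of `c` cancel. -/
theorem exists_edgeToVertex_eq (hN : ∀ σ ∈ nerve V, σ.card ≤ 2) {ε : ℝ} {k : ℕ}
    {c : (chainCosheaf K V ε k).Chains 0} (hc : vertexSum K V ε k c = 0) :
    ∃ b, edgeToVertex K V ε k b = c := by
  classical
  cases k with
  | zero => exact ⟨0, funext fun v => (simplicialChains_zero (K := K) _).trans
      (simplicialChains_zero (K := K) _).symm⟩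
  | succ k =>
    choose v w hvw hv hw hiv hiw hall using fun σ : Simplices (nerve V) 1 => σ.exists_vertices
    have hsum : ∀ t, ∑ x : Simplices (nerve V) 0, chainVal ε (k + 1) x.1 (c x) t = 0 := fun t => by
      rw [← vertexSum_apply, hc]; rfl
    let b : (chainCosheaf K V ε (k + 1)).Chains 1 := fun σ =>
      restrictChain ε (k + 1) (w σ).1 σ.1 (c (w σ))
    have hb : ∀ (σ : Simplices (nerve V) 1) t, Set.range t ⊆ cell V σ.1.1 →
        chainVal ε (k + 1) σ.1 (b σ) t = chainVal ε (k + 1) (w σ).1 (c (w σ)) t :=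
      fun σ t ht => chainVal_restrictChain _ ht
    refine ⟨b, funext fun x => chainVal_injective ε (k + 1) x.1 (funext fun t => ?_)⟩
    by_cases hx : Set.range t ⊆ cell V x.1.1
    -- In the cell of an edge only its two ends can carry a non-zero value of `c`. Outside all such
    -- cells only `x` can, and then the vanishing sum forces that value to be zero.
    · by_cases hσ : ∃ σ : Simplices (nerve V) 1, Set.range t ⊆ cell V σ.1.1
      · obtain ⟨σ, hσ⟩ := hσ
        have hxσ := Simplices.vertex_subset_edge hN (hx ⟨0, rfl⟩) (hσ ⟨0, rfl⟩)
        rw [chainVal_edgeToVertex_of_subset hN b hxσ hσ, hb σ t hσ]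
        have h := hsum t
        rw [Finset.sum_eq_add (v σ) (w σ) (hvw σ) (fun y _ hy => ?_) (by simp) (by simp)] at h
        · rcases hall σ x hxσ with rfl | rfl
          · rw [hiv, eq_neg_of_add_eq_zero_left h]; simp
          · rw [hiw]; simp
        · by_contra hne
          have := Simplices.vertex_subset_edge hN (chainVal_range _ hne ⟨0, rfl⟩) (hσ ⟨0, rfl⟩)
          exact (hall σ y this).elim hy.1 hy.2
      · have h := hsum t
        rw [Finset.sum_eq_single x (fun y _ hy => ?_) (by simp)] at h
        · rw [h, chainVal_edgeToVertex]
          refine Finset.sum_eq_zero fun σ _ => ?_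
          have : chainVal ε (k + 1) σ.1 (b σ) t = 0 := by
            by_contra hne
            exact hσ ⟨σ, chainVal_range _ hne⟩
          rw [this, mul_zero, ite_self]
        · by_contra hne
          exact hσ (Simplices.exists_edge hy (Set.range_nonempty t) (chainVal_range _ hne) hx)
    · have h : ∀ y : (chainCosheaf K V ε (k + 1)).obj x.1, chainVal ε (k + 1) x.1 y t = 0 :=
        fun y => by
          by_contra hne
          exact hx (chainVal_range _ hne)
      rw [h, h]

end MayerVietoris

/-! ## The square of the boundary -/

/-- The double sum over added points p, q cancels in pairs under exchanging p and q. -/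
theorem simplicialBoundary_comp {K : Type u} [Field K] {X : Type v} [Fintype X]
    {Δ : PreAbstractSimplicialComplex X} {k : ℕ} (c : SimplicialChains K Δ (k + 2)) :
    simplicialBoundary K Δ k (simplicialBoundary K Δ (k + 1) c) = 0 := by
  refine Subtype.ext (funext fun t => ?_)
  change (if k = 0 then 0 else ∑ p : X, if k + 1 = 0 then 0 else
    ∑ q : X, c.1 (Fin.cons q (Fin.cons p t : Fin (k + 1) → X))) = 0
  simp only [Nat.add_eq_zero_iff, one_ne_zero, and_false, if_false]
  split_ifs
  · rfl
  have hswap : ∀ p q : X, c.1 (Fin.cons p (Fin.cons q t : Fin (k + 1) → X)) =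
      -c.1 (Fin.cons q (Fin.cons p t : Fin (k + 1) → X)) := fun p q => by
    have h := c.2.1 (Fin.cons q (Fin.cons p t : Fin (k + 1) → X)) (Equiv.swap 0 1)
    rw [Equiv.Perm.sign_swap (by simp)] at h
    simp only [Units.val_neg, Units.val_one, Int.cast_neg, Int.cast_one, neg_mul, one_mul] at h
    rw [← h]
    refine congrArg c.1 (funext fun a => ?_)
    refine Fin.cases ?_ (fun a => Fin.cases ?_ (fun a => ?_) a) a
    · simp
    · simp
    · rw [Function.comp_apply, Equiv.swap_apply_of_ne_of_ne (by simp)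
        (fun h' => by simpa using congrArg Fin.val h')]
      simp
  rw [← Finset.sum_product']
  refine Finset.sum_involution (fun a _ => (a.2, a.1)) (fun a _ => ?_) (fun a _ ha h => ?_)
    (fun _ _ => Finset.mem_univ _) (fun _ _ => rfl)
  · rw [hswap]; exact neg_add_cancel _
  -- Diagonal terms vanish because chains are supported on injective tuples; in characteristic two
  -- the sign rule alone would not give this.
  · have h1 : a.2 = a.1 := congrArg Prod.fst h
    have h2 := (c.2.2 _ ha).1 (a₁ := 0) (a₂ := 1) (by simp [h1])
    simp at h2

/-! ## Families of cycles and their classes -/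

section Classes

variable (K : Type u) [Field K] {X : Type v} [MetricSpace X] [Fintype X] {ι : Type w}
  (V : ι → Set X)

/-- The cosheaf of cycles `σ ↦ Z_{k-1}(R_σ)`. -/
def cycleCosheaf (ε : ℝ) (k : ℕ) : Cosheaf.{u, max u v} K (nerve V) where
  obj σ := cycles (C := fun k => SimplicialChains K (rips (cell V σ.1) ε) k)
    (simplicialBoundary K (rips (cell V σ.1) ε)) k
  map {τ σ} h := (chainIncl K (rips_mono (cell_anti V h) le_rfl) k).restrict
    (map_mem_cycles (C := fun k => SimplicialChains K (rips (cell V σ.1) ε) k)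
      (D := fun k => SimplicialChains K (rips (cell V τ.1) ε) k)
      (chainIncl K (rips_mono (cell_anti V h) le_rfl))
      (chainIncl_boundary K (rips_mono (cell_anti V h) le_rfl)) k)
  map_id _ _ := rfl
  map_comp _ _ _ _ := rfl

/-- The inclusion of the cycles into the chains. -/
def cycleInclusion (ε : ℝ) (k : ℕ) :
    CosheafHom (cycleCosheaf K V ε k) (chainCosheaf K V ε k) where
  app σ := (cycles (C := fun k => SimplicialChains K (rips (cell V σ.1) ε) k)
    (simplicialBoundary K (rips (cell V σ.1) ε)) k).subtype
  naturality _ _ := rfl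

/-- The homology classes of the cycles. -/
def cycleClass (ε : ℝ) (k : ℕ) :
    CosheafHom (cycleCosheaf K V ε k) (lerayCosheaf K V ε k) where
  app σ := homologyClass (C := fun k => SimplicialChains K (rips (cell V σ.1) ε) k)
    (simplicialBoundary K (rips (cell V σ.1) ε)) k
  naturality _ _ := rfl

variable {K V} {ε : ℝ} {k j : ℕ}

/-- A family of cycles as a chain of the cosheaf of cycles. -/
def familyToChains (c : cycleFamilies K V ε k j) : (cycleCosheaf K V ε k).Chains j :=
  fun σ => ⟨c.1 σ, c.2 σ (Set.mem_univ σ)⟩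

/-- A chain of the cosheaf of cycles as a family of cycles. -/
def chainsToFamily (c : (cycleCosheaf K V ε k).Chains j) : cycleFamilies K V ε k j :=
  ⟨(cycleInclusion K V ε k).mapChains j c, fun σ _ => (c σ).2⟩

theorem classFamily_chainsToFamily (c : (cycleCosheaf K V ε k).Chains j) :
    classFamily K V ε k j (chainsToFamily c) = (cycleClass K V ε k).mapChains j c := rfl

theorem classFamily_eq (c : cycleFamilies K V ε k j) :
    classFamily K V ε k j c = (cycleClass K V ε k).mapChains j (familyToChains c) := rfl

theorem classFamily_surjective : Function.Surjective (classFamily K V ε k j) := by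
  intro y
  choose c hc using fun σ => Submodule.Quotient.mk_surjective _ (y σ)
  exact ⟨chainsToFamily c, funext hc⟩

theorem mem_cycleFamilies_succ {c : (chainCosheaf K V ε (k + 1)).Chains j} :
    c ∈ cycleFamilies K V ε (k + 1) j ↔ (chainBoundary K V ε k).mapChains j c = 0 :=
  ⟨fun h => funext fun σ => h σ (Set.mem_univ σ), fun h σ _ => congrFun h σ⟩

theorem mapChains_chainBoundary_comp (c : (chainCosheaf K V ε (k + 2)).Chains j) :
    (chainBoundary K V ε k).mapChains j ((chainBoundary K V ε (k + 1)).mapChains j c) = 0 :=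
  funext fun σ => simplicialBoundary_comp (K := K) (k := k) (c σ)

theorem mapChains_chainBoundary_mem (c : (chainCosheaf K V ε (k + 1)).Chains j) :
    (chainBoundary K V ε k).mapChains j c ∈ cycleFamilies K V ε k j := by
  cases k with
  | zero => exact fun _ _ => trivial
  | succ k => exact mem_cycleFamilies_succ.2 (mapChains_chainBoundary_comp c)

theorem classFamily_eq_zero_iff {c : cycleFamilies K V ε k j} :
    classFamily K V ε k j c = 0 ↔ ∃ a, (chainBoundary K V ε k).mapChains j a = c.1 := by
  constructor
  · intro h
    have : ∀ σ, ∃ a, (chainBoundary K V ε k).app σ.1 a = c.1 σ := fun σ => by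
      obtain ⟨a, ha⟩ := (Submodule.Quotient.mk_eq_zero _).1 (congrFun h σ)
      exact ⟨a, ha⟩
    choose a ha using this
    exact ⟨a, funext ha⟩
  · rintro ⟨a, ha⟩
    exact funext fun σ => (Submodule.Quotient.mk_eq_zero _).2 ⟨a σ, congrFun ha σ⟩

variable [Fintype ι] [LinearOrder ι]

theorem edgeToVertex_mem_cycleFamilies (c : cycleFamilies K V ε k 1) :
    edgeToVertex K V ε k c.1 ∈ cycleFamilies K V ε k 0 := by
  have h := (cycleInclusion K V ε k).mapChains_boundary 0 (familyToChains c)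
  have : edgeToVertex K V ε k c.1 =
    (chainsToFamily ((cycleCosheaf K V ε k).boundary 0 (familyToChains c))).1 := h.symm
  rw [this]
  exact Subtype.mem _

/-- Both sides come from one boundary in the cosheaf of cycles, by naturality of `cycleClass` and of
`cycleInclusion`. -/
theorem boundary_classFamily (c : cycleFamilies K V ε k 1) :
    (lerayCosheaf K V ε k).boundary 0 (classFamily K V ε k 1 c) =
      classFamily K V ε k 0 ⟨_, edgeToVertex_mem_cycleFamilies c⟩ := by
  rw [classFamily_eq, ← CosheafHom.mapChains_boundary, ← classFamily_chainsToFamily]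
  congr 1
  exact Subtype.ext ((cycleInclusion K V ε k).mapChains_boundary 0 (familyToChains c))

theorem mapChains_edgeToVertex (c : (chainCosheaf K V ε (k + 1)).Chains 1) :
    (chainBoundary K V ε k).mapChains 0 (edgeToVertex K V ε (k + 1) c) =
      edgeToVertex K V ε k ((chainBoundary K V ε k).mapChains 1 c) :=
  (chainBoundary K V ε k).mapChains_boundary 0 c

/-- From e ∂c = ∂ e c = ∂∂G = 0 and the injectivity of e. -/
theorem mem_cycleFamilies_of_edgeToVertex_eq (hN : ∀ σ ∈ nerve V, σ.card ≤ 2)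
    {c : (chainCosheaf K V ε k).Chains 1} {G : (chainCosheaf K V ε (k + 1)).Chains 0}
    (h : (chainBoundary K V ε k).mapChains 0 G = edgeToVertex K V ε k c) :
    c ∈ cycleFamilies K V ε k 1 := by
  cases k with
  | zero => exact fun _ _ => trivial
  | succ k =>
    refine mem_cycleFamilies_succ.2 (edgeToVertex_injective hN ε k ?_)
    rw [← mapChains_edgeToVertex, ← h, mapChains_chainBoundary_comp, map_zero]

/-! ### Classes in `H_0` -/

theorem classH0_surjective : Function.Surjective (classH0 K V ε k) := by
  intro y
  obtain ⟨⟨y, hy⟩, rfl⟩ := Submodule.Quotient.mk_surjective _ y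
  obtain ⟨c, rfl⟩ := classFamily_surjective y
  exact ⟨c, rfl⟩

theorem classH0_eq_zero {z : cycleFamilies K V ε k 0} {a : (chainCosheaf K V ε (k + 1)).Chains 0}
    {u : cycleFamilies K V ε k 1}
    (h : z.1 = (chainBoundary K V ε k).mapChains 0 a + edgeToVertex K V ε k u.1) :
    classH0 K V ε k z = 0 := by
  refine (Submodule.Quotient.mk_eq_zero _).2 ⟨classFamily K V ε k 1 u, ?_⟩
  have hz : z = ⟨_, mapChains_chainBoundary_mem a⟩ + ⟨_, edgeToVertex_mem_cycleFamilies u⟩ :=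
    Subtype.ext h
  change _ = classFamily K V ε k 0 z
  have ha : classFamily K V ε k 0 ⟨_, mapChains_chainBoundary_mem a⟩ = 0 :=
    classFamily_eq_zero_iff.2 ⟨a, rfl⟩
  rw [boundary_classFamily, hz, map_add, ha]
  exact (zero_add _).symm

theorem mapH0_classH0 {ε' : ℝ} (h : ε ≤ ε') {n : ℕ} (z : cycleFamilies K V ε (n + 1) 0)
    (z' : cycleFamilies K V ε' (n + 1) 0)
    (hz : z'.1 = (chainInclusion K V h (n + 1)).mapChains 0 z.1) :
    mapH0 K V h n (classH0 K V ε (n + 1) z) = classH0 K V ε' (n + 1) z' := by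
  obtain ⟨z', hz'⟩ := z'
  obtain rfl : z' = _ := hz
  rfl

/-! ### Classes in `H_1` -/

theorem RepresentsH1.unique {c : cycleFamilies K V ε k 1} {y y' : (lerayCosheaf K V ε k).H 1}
    (h : RepresentsH1 K V c y) (h' : RepresentsH1 K V c y') : y = y' :=
  h.2.symm.trans h'.2

theorem RepresentsH1.add {c c' : cycleFamilies K V ε k 1} {y y' : (lerayCosheaf K V ε k).H 1}
    (h : RepresentsH1 K V c y) (h' : RepresentsH1 K V c' y') :
    RepresentsH1 K V (c + c') (y + y') := by
  obtain ⟨h, rfl⟩ := h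
  obtain ⟨h', rfl⟩ := h'
  exact ⟨by rw [map_add]; exact add_mem h h', rfl⟩

theorem RepresentsH1.smul (r : K) {c : cycleFamilies K V ε k 1} {y : (lerayCosheaf K V ε k).H 1}
    (h : RepresentsH1 K V c y) : RepresentsH1 K V (r • c) (r • y) := by
  obtain ⟨h, rfl⟩ := h
  exact ⟨by rw [map_smul]; exact Submodule.smul_mem _ r h, rfl⟩

theorem RepresentsH1.zero : RepresentsH1 K V (0 : cycleFamilies K V ε k 1) 0 :=
  ⟨by rw [map_zero]; exact zero_mem _, rfl⟩

theorem exists_representsH1 (y : (lerayCosheaf K V ε k).H 1) :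
    ∃ c : cycleFamilies K V ε k 1, RepresentsH1 K V c y := by
  obtain ⟨⟨y, hy⟩, rfl⟩ := Submodule.Quotient.mk_surjective _ y
  obtain ⟨c, rfl⟩ := classFamily_surjective y
  exact ⟨c, hy, rfl⟩

/-- That ⟨c⟩ is a cosheaf cycle means that `e c` bounds over every vertex. -/
theorem RepresentsH1.exists_boundary_eq {c : cycleFamilies K V ε k 1}
    {y : (lerayCosheaf K V ε k).H 1} (h : RepresentsH1 K V c y) :
    ∃ G : (chainCosheaf K V ε (k + 1)).Chains 0,
      (chainBoundary K V ε k).mapChains 0 G = edgeToVertex K V ε k c.1 := by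
  obtain ⟨h, -⟩ := h
  have h' : (lerayCosheaf K V ε k).boundary 0 (classFamily K V ε k 1 c) = 0 := h
  rw [boundary_classFamily] at h'
  exact classFamily_eq_zero_iff.1 h'

theorem exists_representsH1_of_boundary_eq {c : cycleFamilies K V ε k 1}
    {G : (chainCosheaf K V ε (k + 1)).Chains 0}
    (h : (chainBoundary K V ε k).mapChains 0 G = edgeToVertex K V ε k c.1) :
    ∃ y, RepresentsH1 K V c y := by
  have h' : (lerayCosheaf K V ε k).boundary 0 (classFamily K V ε k 1 c) = 0 := by
    rw [boundary_classFamily]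
    exact classFamily_eq_zero_iff.2 ⟨G, h⟩
  exact ⟨_, h', rfl⟩

/-- Without 2-simplices in the nerve, H_1 is the space of cosheaf cycles itself, so a class vanishes
only if all the homology classes over the edges do. -/
theorem representsH1_zero_iff (hN : ∀ σ ∈ nerve V, σ.card ≤ 2) {c : cycleFamilies K V ε k 1} :
    RepresentsH1 K V c 0 ↔ ∃ a, (chainBoundary K V ε k).mapChains 1 a = c.1 := by
  have := isEmpty_simplices_two hN
  rw [← classFamily_eq_zero_iff]
  constructor
  · rintro ⟨h, h0⟩
    obtain ⟨b, hb⟩ := (Submodule.Quotient.mk_eq_zero _).1 h0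
    have hb' : (lerayCosheaf K V ε k).boundary 1 b = classFamily K V ε k 1 c := hb
    rw [← hb', Subsingleton.elim b 0, map_zero]
  · intro h
    exact ⟨by rw [h]; exact zero_mem _, by
      have : (⟨classFamily K V ε k 1 c, by rw [h]; exact zero_mem _⟩ :
        cycles (lerayCosheaf K V ε k).boundary 1) = 0 := Subtype.ext h
      rw [this, map_zero]⟩

/-- The image of a family of cycles at a larger parameter. -/
def inclFamily {ε' : ℝ} (h : ε ≤ ε') (c : cycleFamilies K V ε k j) :
    cycleFamilies K V ε' k j :=
  ⟨(chainInclusion K V h k).mapChains j c.1, fun σ _ =>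
    map_mem_cycles (C := fun k => SimplicialChains K (rips (cell V σ.1.1) ε) k)
      (D := fun k => SimplicialChains K (rips (cell V σ.1.1) ε') k)
      (chainIncl K (rips_mono subset_rfl h)) (chainIncl_boundary K (rips_mono subset_rfl h)) k
      (c.1 σ) (c.2 σ (Set.mem_univ σ))⟩

theorem RepresentsH1.map {ε' : ℝ} (h : ε ≤ ε') {c : cycleFamilies K V ε k 1}
    {y : (lerayCosheaf K V ε k).H 1} (hc : RepresentsH1 K V c y) :
    RepresentsH1 K V (inclFamily h c) (mapH1 K V h k y) := by
  obtain ⟨hc, rfl⟩ := hc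
  exact ⟨map_mem_cycles (lerayMorphism K V h k).mapChains
    (lerayMorphism K V h k).mapChains_boundary 1 _ hc, rfl⟩

end Classes

/-! ## Instances on cycles and homology -/

section Instances

variable {K : Type u} [Field K] {X : Type v} [Fintype X] (Δ : PreAbstractSimplicialComplex X)
  (k : ℕ)

instance : AddCommGroup (cycles (C := fun k => SimplicialChains K Δ k)
    (simplicialBoundary K Δ) k) := Submodule.addCommGroup _

instance : Module K (cycles (C := fun k => SimplicialChains K Δ k)
    (simplicialBoundary K Δ) k) := Submodule.module _

instance : AddCommGroup (SimplicialHomology K Δ k) := Submodule.Quotient.addCommGroup _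

instance : Module K (SimplicialHomology K Δ k) := Submodule.Quotient.module _

end Instances

/-! ## The homology of the Rips complex and the cosheaf homology -/

section Total

variable {K : Type u} [Field K] {X : Type v} [MetricSpace X] [Fintype X] {ι : Type w}
  [Fintype ι] {V : ι → Set X} {ε : ℝ}

theorem vertexSum_chainBoundary (k : ℕ) (c : (chainCosheaf K V ε (k + 1)).Chains 0) :
    vertexSum K V ε k ((chainBoundary K V ε k).mapChains 0 c) =
      simplicialBoundary K (rips Set.univ ε) k (vertexSum K V ε (k + 1) c) := by
  simp only [vertexSum, LinearMap.sum_apply, map_sum]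
  rfl

variable (K V) in
/-- The families of `n`-chains over the vertices whose sum is a cycle. -/
def vertexCycles (ε : ℝ) (n : ℕ) : Submodule K ((chainCosheaf K V ε (n + 1)).Chains 0) :=
  LinearMap.ker (vertexSum K V ε n ∘ₗ (chainBoundary K V ε n).mapChains 0)

variable (K X) in
/-- The cycles of the Rips complex on all points. -/
abbrev ripsCycles (ε : ℝ) (k : ℕ) : Submodule K (SimplicialChains K (rips (Set.univ : Set X) ε) k) :=
  cycles (C := fun k => SimplicialChains K (rips (Set.univ : Set X) ε) k)
    (simplicialBoundary K (rips Set.univ ε)) k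

variable (K X) in
/-- The homology class of a cycle of the Rips complex on all points. -/
def ripsClass (ε : ℝ) (k : ℕ) :
    ripsCycles K X ε k →ₗ[K] SimplicialHomology K (rips (Set.univ : Set X) ε) k :=
  homologyClass (C := fun k => SimplicialChains K (rips (Set.univ : Set X) ε) k)
    (simplicialBoundary K (rips Set.univ ε)) k

theorem ripsClass_surjective (ε : ℝ) (k : ℕ) : Function.Surjective (ripsClass K X ε k) :=
  Submodule.Quotient.mk_surjective _

theorem ripsClass_eq_zero_iff {k : ℕ} {z : ripsCycles K X ε k} :
    ripsClass K X ε k z = 0 ↔ ∃ b, simplicialBoundary K (rips Set.univ ε) k b = z.1 :=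
  Submodule.Quotient.mk_eq_zero _

theorem vertexSum_mem_ripsCycles {n : ℕ} {G : (chainCosheaf K V ε (n + 1)).Chains 0}
    (hG : G ∈ vertexCycles K V ε n) : vertexSum K V ε (n + 1) G ∈ ripsCycles K X ε (n + 1) :=
  (vertexSum_chainBoundary n G).symm.trans hG

variable (K V) in
/-- The homology class of the sum of a family of chains over the vertices. -/
def vertexClass (ε : ℝ) (n : ℕ) :
    vertexCycles K V ε n →ₗ[K] SimplicialHomology K (rips (Set.univ : Set X) ε) (n + 1) :=
  ripsClass K X ε (n + 1) ∘ₗ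
    (vertexSum K V ε (n + 1)).restrict fun _ hG => vertexSum_mem_ripsCycles hG

theorem vertexClass_surjective (hR : ∀ s ∈ rips (Set.univ : Set X) ε, ∃ i, (s : Set X) ⊆ V i)
    (n : ℕ) : Function.Surjective (vertexClass K V ε n) := by
  intro z
  obtain ⟨⟨z, hz⟩, rfl⟩ := ripsClass_surjective ε _ z
  obtain ⟨G, rfl⟩ := vertexSum_surjective hR _ z
  exact ⟨⟨G, (vertexSum_chainBoundary n G).trans hz⟩, rfl⟩

theorem chainInclusion_mem_vertexCycles {ε' : ℝ} (h : ε ≤ ε') {n : ℕ}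
    {G : (chainCosheaf K V ε (n + 1)).Chains 0} (hG : G ∈ vertexCycles K V ε n) :
    (chainInclusion K V h (n + 1)).mapChains 0 G ∈ vertexCycles K V ε' n := by
  have hG' : vertexSum K V ε n ((chainBoundary K V ε n).mapChains 0 G) = 0 := hG
  have := vertexSum_chainInclusion h n ((chainBoundary K V ε n).mapChains 0 G)
  rw [hG', map_zero] at this
  exact this

theorem simplicialHomologyIncl_vertexClass {ε' : ℝ} (h : ε ≤ ε') {n : ℕ}
    {G : (chainCosheaf K V ε (n + 1)).Chains 0} (hG : G ∈ vertexCycles K V ε n) :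
    simplicialHomologyIncl K (rips_mono subset_rfl h) (n + 1) (vertexClass K V ε n ⟨G, hG⟩) =
      vertexClass K V ε' n ⟨_, chainInclusion_mem_vertexCycles h hG⟩ := by
  refine congrArg (ripsClass K X ε' (n + 1)) (Subtype.ext ?_)
  exact (vertexSum_chainInclusion h (n + 1) G).symm

theorem mem_vertexCycles_of_mem_cycleFamilies {n : ℕ}
    {z : (chainCosheaf K V ε (n + 1)).Chains 0} (hz : z ∈ cycleFamilies K V ε (n + 1) 0) :
    z ∈ vertexCycles K V ε n := by
  have h := mem_cycleFamilies_succ.1 hz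
  change vertexSum K V ε n ((chainBoundary K V ε n).mapChains 0 z) = 0
  rw [h, map_zero]

variable (K V) in
/-- The map `H_n(R_σ) → H_n(R)`. -/
def homologyToTotal (ε : ℝ) (k : ℕ) (σ : nerve V) : (lerayCosheaf K V ε k).obj σ →ₗ[K]
    SimplicialHomology K (rips (Set.univ : Set X) ε) k :=
  simplicialHomologyIncl K (rips_mono (Set.subset_univ (cell V σ.1)) (le_refl ε)) k

variable (K V) in
open Classical in
/-- The sum of the maps `H_n(R_v) → H_n(R)`. -/
def vertexHomologySum (ε : ℝ) (n : ℕ) : (lerayCosheaf K V ε (n + 1)).Chains 0 →ₗ[K]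
    SimplicialHomology K (rips (Set.univ : Set X) ε) (n + 1) :=
  ∑ v : Simplices (nerve V) 0, homologyToTotal K V ε (n + 1) v.1 ∘ₗ LinearMap.proj v

theorem vertexHomologySum_classFamily {n : ℕ} (z : cycleFamilies K V ε (n + 1) 0) :
    vertexHomologySum K V ε n (classFamily K V ε (n + 1) 0 z) =
      vertexClass K V ε n ⟨z.1, mem_vertexCycles_of_mem_cycleFamilies z.2⟩ := by
  classical
  have hmem : ∀ v : Simplices (nerve V) 0,
      chainToTotal ε (n + 1) v.1 (z.1 v) ∈ ripsCycles K X ε (n + 1) := fun v =>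
    map_mem_cycles (C := fun k => SimplicialChains K (rips (cell V v.1.1) ε) k)
      (D := fun k => SimplicialChains K (rips (Set.univ : Set X) ε) k)
      (chainIncl K (rips_mono (Set.subset_univ _) le_rfl))
      (chainIncl_boundary K (rips_mono (Set.subset_univ _) le_rfl)) (n + 1) _
      (z.2 v (Set.mem_univ v))
  have hsum : (⟨vertexSum K V ε (n + 1) z.1, vertexSum_mem_ripsCycles
      (mem_vertexCycles_of_mem_cycleFamilies z.2)⟩ : ripsCycles K X ε (n + 1)) =
      ∑ v : Simplices (nerve V) 0, ⟨_, hmem v⟩ := by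
    refine Subtype.ext ?_
    rw [Submodule.coe_sum]
    simp only [vertexSum, LinearMap.sum_apply]
    rfl
  refine Eq.trans ?_ (congrArg (ripsClass K X ε (n + 1)) hsum).symm
  simp only [vertexHomologySum, LinearMap.sum_apply, map_sum]
  rfl

variable [LinearOrder ι]

theorem mem_vertexCycles_of_boundary_eq {n : ℕ} {G : (chainCosheaf K V ε (n + 1)).Chains 0}
    {c : (chainCosheaf K V ε n).Chains 1}
    (h : (chainBoundary K V ε n).mapChains 0 G = edgeToVertex K V ε n c) :
    G ∈ vertexCycles K V ε n := by
  change vertexSum K V ε n ((chainBoundary K V ε n).mapChains 0 G) = 0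
  rw [h, vertexSum_edgeToVertex]

theorem vertexClass_eq_zero_of_eq {n : ℕ} {G : (chainCosheaf K V ε (n + 1)).Chains 0}
    (hG : G ∈ vertexCycles K V ε n) {a : (chainCosheaf K V ε (n + 2)).Chains 0}
    {u : (chainCosheaf K V ε (n + 1)).Chains 1}
    (h : G = (chainBoundary K V ε (n + 1)).mapChains 0 a + edgeToVertex K V ε (n + 1) u) :
    vertexClass K V ε n ⟨G, hG⟩ = 0 := by
  refine ripsClass_eq_zero_iff.2 ⟨vertexSum K V ε (n + 2) a, ?_⟩
  change _ = vertexSum K V ε (n + 1) G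
  rw [h, map_add, vertexSum_edgeToVertex, add_zero, vertexSum_chainBoundary]

/-- A chain bounded by the sum of `G` is lifted to the vertices as `a`; then G - ∂a has sum zero and
comes from the edges. -/
theorem exists_eq_of_vertexClass_eq_zero (hN : ∀ σ ∈ nerve V, σ.card ≤ 2)
    (hR : ∀ s ∈ rips (Set.univ : Set X) ε, ∃ i, (s : Set X) ⊆ V i)
    {n : ℕ} {G : (chainCosheaf K V ε (n + 1)).Chains 0}
    (hG : G ∈ vertexCycles K V ε n) (h : vertexClass K V ε n ⟨G, hG⟩ = 0) :
    ∃ (a : (chainCosheaf K V ε (n + 2)).Chains 0) (u : (chainCosheaf K V ε (n + 1)).Chains 1),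
      G = (chainBoundary K V ε (n + 1)).mapChains 0 a + edgeToVertex K V ε (n + 1) u := by
  obtain ⟨b, hb⟩ := ripsClass_eq_zero_iff.1 h
  obtain ⟨a, rfl⟩ := vertexSum_surjective hR _ b
  have hb' : simplicialBoundary K (rips Set.univ ε) (n + 1) (vertexSum K V ε (n + 2) a) =
    vertexSum K V ε (n + 1) G := hb
  have h0 : vertexSum K V ε (n + 1) (G - (chainBoundary K V ε (n + 1)).mapChains 0 a) = 0 := by
    rw [map_sub, vertexSum_chainBoundary, hb', sub_self]
  obtain ⟨u, hu⟩ := exists_edgeToVertex_eq hN h0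
  exact ⟨a, u, by rw [hu, add_sub_cancel]⟩

variable (K V) in
/-- The map `H_0(C_• F_n) → H_n(R)` induced by the inclusions of the `R_v`. -/
def sumH0 (ε : ℝ) (n : ℕ) : (lerayCosheaf K V ε (n + 1)).H 0 →ₗ[K]
    SimplicialHomology K (rips (Set.univ : Set X) ε) (n + 1) :=
  Submodule.liftQ _ (vertexHomologySum K V ε n ∘ₗ Submodule.subtype _) (by
    rintro ⟨y, hy⟩ ⟨u, hu⟩
    obtain ⟨u, rfl⟩ := classFamily_surjective u
    obtain rfl : _ = y := hu
    -- Well-definedness: a cosheaf boundary is the class of some `e u`, and this has sum zero.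
    have h : vertexHomologySum K V ε n
        ((lerayCosheaf K V ε (n + 1)).boundary 0 (classFamily K V ε (n + 1) 1 u)) = 0 := by
      rw [boundary_classFamily, vertexHomologySum_classFamily]
      exact vertexClass_eq_zero_of_eq (a := 0) (u := u.1) _ (by
        rw [map_zero]; exact (zero_add _).symm)
    exact h)

theorem sumH0_classH0 {n : ℕ} (z : cycleFamilies K V ε (n + 1) 0) :
    sumH0 K V ε n (classH0 K V ε (n + 1) z) =
      vertexClass K V ε n ⟨z.1, mem_vertexCycles_of_mem_cycleFamilies z.2⟩ :=
  vertexHomologySum_classFamily z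

end Total

/-! ## The isomorphism defined by a section -/

section Section

variable {K : Type u} [Field K] {X : Type v} [MetricSpace X] [Fintype X] {ι : Type w}
  [Fintype ι] [LinearOrder ι] {V : ι → Set X} {ε : ℝ} {n : ℕ}

/-- `G` is a family of chains over the vertices with `∂ G = e c` for a representative `c` of `y`. -/
def IsLift (y : (lerayCosheaf K V ε n).H 1) (G : (chainCosheaf K V ε (n + 1)).Chains 0) : Prop :=
  ∃ c : cycleFamilies K V ε n 1, RepresentsH1 K V c y ∧
    (chainBoundary K V ε n).mapChains 0 G = edgeToVertex K V ε n c.1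

theorem IsLift.mem {y : (lerayCosheaf K V ε n).H 1} {G : (chainCosheaf K V ε (n + 1)).Chains 0}
    (h : IsLift y G) : G ∈ vertexCycles K V ε n := by
  obtain ⟨c, -, hc⟩ := h
  exact mem_vertexCycles_of_boundary_eq hc

/-- A linear section of the connecting homomorphism `H_n(R) → H_1(C_• F_{n-1})` of the
Mayer-Vietoris sequence. -/
def IsSection (s : (lerayCosheaf K V ε n).H 1 →ₗ[K]
    SimplicialHomology K (rips (Set.univ : Set X) ε) (n + 1)) : Prop :=
  ∀ y, ∃ (G : (chainCosheaf K V ε (n + 1)).Chains 0) (h : IsLift y G),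
    s y = vertexClass K V ε n ⟨G, h.mem⟩

/-- The map `H_0(C_• F_n) ⊕ H_1(C_• F_{n-1}) → H_n(R)` defined by a section and a scalar. -/
def sectionMap (s : (lerayCosheaf K V ε n).H 1 →ₗ[K]
    SimplicialHomology K (rips (Set.univ : Set X) ε) (n + 1)) (r : K) :
    ((lerayCosheaf K V ε (n + 1)).H 0 × (lerayCosheaf K V ε n).H 1) →ₗ[K]
      SimplicialHomology K (rips (Set.univ : Set X) ε) (n + 1) :=
  (sumH0 K V ε n).coprod (r • s)

/-- An element of the kernel gives z + rG = ∂a + e u. Applying ∂ yields r c = ∂u, since e is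
injective, so y = 0. Then z = ∂a + e u for new a, u, and the same argument gives ∂u = 0, so z has
class zero. -/
theorem sectionMap_injective (hN : ∀ σ ∈ nerve V, σ.card ≤ 2)
    (hR : ∀ s ∈ rips (Set.univ : Set X) ε, ∃ i, (s : Set X) ⊆ V i)
    {s : (lerayCosheaf K V ε n).H 1 →ₗ[K]
      SimplicialHomology K (rips (Set.univ : Set X) ε) (n + 1)} (hs : IsSection s) {r : K}
    (hr : r ≠ 0) : Function.Injective (sectionMap s r) := by
  rw [injective_iff_map_eq_zero]
  rintro ⟨x, y⟩ hxy
  obtain ⟨z, rfl⟩ := classH0_surjective x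
  obtain ⟨G, ⟨c, hcy, hc⟩, hG⟩ := hs y
  have hz := mem_cycleFamilies_succ.1 z.2
  have hzm := mem_vertexCycles_of_mem_cycleFamilies z.2
  have hGm := mem_vertexCycles_of_boundary_eq hc
  have hxy' : sumH0 K V ε n (classH0 K V ε (n + 1) z) + r • s y = 0 := hxy
  have hy : y = 0 := by
    rw [sumH0_classH0, hG, ← map_smul, ← map_add] at hxy'
    obtain ⟨a, u, hau⟩ := exists_eq_of_vertexClass_eq_zero hN hR _ hxy'
    have h : (chainBoundary K V ε n).mapChains 0 (z.1 + r • G) = _ :=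
      congrArg ((chainBoundary K V ε n).mapChains 0) hau
    rw [map_add, map_add, map_smul, hz, hc, mapChains_chainBoundary_comp, mapChains_edgeToVertex,
      ← map_smul] at h
    have h' := edgeToVertex_injective hN ε n
      ((zero_add _).symm.trans (h.trans (zero_add _)))
    have h0 := (representsH1_zero_iff hN (c := r • c)).2 ⟨u, h'.symm⟩
    exact (smul_eq_zero.1 ((hcy.smul r).unique h0)).resolve_left hr
  subst hy
  rw [map_zero, smul_zero, add_zero, sumH0_classH0] at hxy'
  obtain ⟨a, u, hau⟩ := exists_eq_of_vertexClass_eq_zero hN hR _ hxy'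
  have h := congrArg ((chainBoundary K V ε n).mapChains 0) hau
  rw [map_add, hz, mapChains_chainBoundary_comp, mapChains_edgeToVertex] at h
  have hu : u ∈ cycleFamilies K V ε (n + 1) 1 := mem_cycleFamilies_succ.2
    (edgeToVertex_injective hN ε n
      (((zero_add _).symm.trans h.symm).trans (map_zero _).symm))
  rw [classH0_eq_zero (u := ⟨u, hu⟩) hau]
  rfl

/-- For a family G whose sum is a cycle, ∂G = e u, and u represents a class y. The section lifts y
by some G' with ∂G' = e c, where c - u = ∂a, and what is left of G after removing G' comes from H_0.
-/
theorem sectionMap_surjective (hN : ∀ σ ∈ nerve V, σ.card ≤ 2)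
    (hR : ∀ s ∈ rips (Set.univ : Set X) ε, ∃ i, (s : Set X) ⊆ V i)
    {s : (lerayCosheaf K V ε n).H 1 →ₗ[K]
      SimplicialHomology K (rips (Set.univ : Set X) ε) (n + 1)} (hs : IsSection s) {r : K}
    (hr : r ≠ 0) : Function.Surjective (sectionMap s r) := by
  intro q
  obtain ⟨⟨G, hGm⟩, rfl⟩ := vertexClass_surjective hR n q
  obtain ⟨u, hu⟩ := exists_edgeToVertex_eq hN hGm
  have hum := mem_cycleFamilies_of_edgeToVertex_eq hN hu.symm
  obtain ⟨y, hy⟩ := exists_representsH1_of_boundary_eq (c := ⟨u, hum⟩) hu.symm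
  obtain ⟨G', ⟨c, hcy, hc⟩, hG'⟩ := hs y
  have h0 : RepresentsH1 K V (c + (-1 : K) • ⟨u, hum⟩) 0 := by
    have := hcy.add (hy.smul (-1))
    rwa [neg_one_smul K y, add_neg_cancel] at this
  obtain ⟨a, ha⟩ := (representsH1_zero_iff hN).1 h0
  have ha' : (chainBoundary K V ε n).mapChains 1 a = c.1 - u := by
    rw [ha, sub_eq_add_neg, ← neg_one_smul K u]; rfl
  -- Adding `e a` makes G - G' a family of cycles without changing its sum.
  have hz : G - G' + edgeToVertex K V ε (n + 1) a ∈ cycleFamilies K V ε (n + 1) 0 := by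
    refine mem_cycleFamilies_succ.2 ?_
    rw [map_add, map_sub, mapChains_edgeToVertex, ha', hc, ← hu, map_sub]
    abel
  refine ⟨(classH0 K V ε (n + 1) ⟨_, hz⟩, r⁻¹ • y), ?_⟩
  change sumH0 K V ε n (classH0 K V ε (n + 1) ⟨_, hz⟩) + r • s (r⁻¹ • y) = _
  rw [map_smul, smul_inv_smul₀ hr, sumH0_classH0, hG', ← map_add, ← sub_eq_zero, ← map_sub]
  refine vertexClass_eq_zero_of_eq _ (a := 0) (u := a) ?_
  rw [map_zero]
  change G - G' + edgeToVertex K V ε (n + 1) a + G' - G = _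
  abel

end Section

/-! ## The sections defined by the choices -/

section Stages

variable {K : Type u} [Field K] {X : Type v} [MetricSpace X] [Fintype X] {ι : Type w}
  [Fintype ι] [LinearOrder ι] {V : ι → Set X} {ε ε' : ℝ} {n : ℕ}

/-- The linear map to `H_n(R)` defined by lifts of the vectors of a basis. -/
def basisSection {κ : Type*} (B : Module.Basis κ K ((lerayCosheaf K V ε n).H 1))
    {G : κ → (chainCosheaf K V ε (n + 1)).Chains 0} (hG : ∀ r, IsLift (B r) (G r)) :
    (lerayCosheaf K V ε n).H 1 →ₗ[K] SimplicialHomology K (rips (Set.univ : Set X) ε) (n + 1) :=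
  B.constr K fun r => vertexClass K V ε n ⟨G r, (hG r).mem⟩

theorem basisSection_apply {κ : Type*} (B : Module.Basis κ K ((lerayCosheaf K V ε n).H 1))
    {G : κ → (chainCosheaf K V ε (n + 1)).Chains 0} (hG : ∀ r, IsLift (B r) (G r)) (r : κ) :
    basisSection B hG (B r) = vertexClass K V ε n ⟨G r, (hG r).mem⟩ :=
  B.constr_basis K _ r

theorem IsLift.zero : IsLift (0 : (lerayCosheaf K V ε n).H 1) 0 :=
  ⟨0, RepresentsH1.zero, by rw [map_zero]; exact (map_zero _).symm⟩

theorem IsLift.add {y y' : (lerayCosheaf K V ε n).H 1}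
    {G G' : (chainCosheaf K V ε (n + 1)).Chains 0} (h : IsLift y G) (h' : IsLift y' G') :
    IsLift (y + y') (G + G') := by
  obtain ⟨c, hc, hG⟩ := h
  obtain ⟨c', hc', hG'⟩ := h'
  exact ⟨c + c', hc.add hc', by rw [map_add, hG, hG']; exact (map_add _ _ _).symm⟩

theorem IsLift.smul (r : K) {y : (lerayCosheaf K V ε n).H 1}
    {G : (chainCosheaf K V ε (n + 1)).Chains 0} (h : IsLift y G) : IsLift (r • y) (r • G) := by
  obtain ⟨c, hc, hG⟩ := h
  exact ⟨r • c, hc.smul r, by rw [map_smul, hG]; exact (map_smul _ _ _).symm⟩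

/-- Lifts are closed under linear combinations, so the property passes from the basis to its span.
-/
theorem isSection_basisSection {κ : Type*} (B : Module.Basis κ K ((lerayCosheaf K V ε n).H 1))
    {G : κ → (chainCosheaf K V ε (n + 1)).Chains 0} (hG : ∀ r, IsLift (B r) (G r)) :
    IsSection (basisSection B hG) := by
  intro y
  have hy : y ∈ Submodule.span K (Set.range B) := by rw [B.span_eq]; trivial
  induction hy using Submodule.span_induction with
  | mem y hy =>
    obtain ⟨r, rfl⟩ := hy
    exact ⟨G r, hG r, basisSection_apply B hG r⟩
  | zero => exact ⟨0, IsLift.zero, by rw [map_zero]; exact (map_zero _).symm⟩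
  | add y y' _ _ h h' =>
    obtain ⟨G, h, hs⟩ := h
    obtain ⟨G', h', hs'⟩ := h'
    exact ⟨G + G', h.add h', by rw [map_add, hs, hs', ← map_add]; rfl⟩
  | smul r y _ h =>
    obtain ⟨G, h, hs⟩ := h
    exact ⟨r • G, h.smul r, by rw [map_smul, hs, ← map_smul]; rfl⟩

namespace StageChoice

variable {h : ε ≤ ε'} (S : StageChoice K V h n)

theorem basis_inl (r : Fin S.a) : S.basis (Sum.inl r) = S.basisA r := by
  simp [basis]

theorem basis_inr (r : Fin S.b) : S.basis (Sum.inr r) = S.basisKer r := by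
  simp [basis]

theorem representsH1_rep (r : Fin S.a ⊕ Fin S.b) : RepresentsH1 K V (S.rep r) (S.basis r) := by
  rcases r with r | r
  · rw [basis_inl]; exact S.rep_inl r
  · rw [basis_inr]; exact S.rep_inr r

theorem isLift_Gam (r : Fin S.a ⊕ Fin S.b) : IsLift (S.basis r) (S.Gam r) :=
  ⟨S.rep r, S.representsH1_rep r, S.boundary_Gam r⟩

/-- The section defined by the choices `S`. -/
def toSection : (lerayCosheaf K V ε n).H 1 →ₗ[K]
    SimplicialHomology K (rips (Set.univ : Set X) ε) (n + 1) :=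
  basisSection S.basis S.isLift_Gam

theorem isSection_toSection : IsSection S.toSection :=
  isSection_basisSection _ _

/-- On `A`, the sections of consecutive choices are compatible. -/
theorem Follows.toSection_basisA {ε'' : ℝ} {h' : ε' ≤ ε''} {S : StageChoice K V h n}
    {S' : StageChoice K V h' n} (hS : Follows S S') (r : Fin S.a) :
    S'.toSection (mapH1 K V h n (S.basisA r)) =
      simplicialHomologyIncl K (rips_mono subset_rfl h) (n + 1) (S.toSection (S.basisA r)) := by
  obtain ⟨d, C, crep, GamC, hC, hcrep, hGamC, hrep, hbd, hS'rep, hS'Gam⟩ := hS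
  have hinl : ∀ r, crep (Sum.inl r) = inclFamily h (S.rep (Sum.inl r)) := fun r =>
    Subtype.ext (hcrep r)
  have hlift : ∀ s, IsLift (C s) (GamC s) := by
    rintro (s | s)
    · refine ⟨crep (Sum.inl s), ?_, ?_⟩
      · rw [hC, hinl]
        exact (S.rep_inl s).map h
      · rw [hGamC, hcrep]
        refine Eq.trans ?_ ((chainInclusion K V h n).mapChains_boundary 0 _)
        refine Eq.trans ?_ (congrArg ((chainInclusion K V h n).mapChains 0)
          (S.boundary_Gam (Sum.inl s)))
        rfl
    · exact ⟨_, hrep s, hbd s⟩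
  -- Since Γ' has the coordinates of its basis vectors in `C`, both bases define the same section;
  -- its values on the images of A are then known from `GamC`.
  have heq : S'.toSection = basisSection C hlift := by
    refine S'.basis.ext fun r => ?_
    refine (basisSection_apply _ _ r).trans ?_
    rw [basisSection, Module.Basis.constr_apply_fintype]
    simp only [Module.Basis.equivFun_apply, ← map_smul, ← map_sum]
    congr 1
    refine Subtype.ext ?_
    rw [Submodule.coe_sum]
    exact hS'Gam r
  rw [heq, ← hC, basisSection_apply, ← basis_inl]
  refine Eq.trans ?_ (congrArg _ (basisSection_apply S.basis S.isLift_Gam (Sum.inl r))).symm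
  refine Eq.trans ?_ (simplicialHomologyIncl_vertexClass h _).symm
  congr 1
  exact Subtype.ext (hGamC r)

end StageChoice

end Stages

/-! ## Existence of consistent choices -/

section Existence

variable {K : Type u} [Field K] {X : Type v} [MetricSpace X] [Fintype X] {ι : Type w}
  {V : ι → Set X} {ε ε' : ℝ} {n : ℕ}

instance finite_simplicialChains (Δ : PreAbstractSimplicialComplex X) (k : ℕ) :
    Module.Finite K (SimplicialChains K Δ k) := by
  classical infer_instance

instance finite_lerayCosheaf_obj (ε : ℝ) (k : ℕ) (σ : nerve V) :
    Module.Finite K ((lerayCosheaf K V ε k).obj σ) :=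
  Module.Finite.of_surjective (homologyClass (C := fun k => SimplicialChains K _ k)
    (simplicialBoundary K (rips (cell V σ.1) ε)) k) (Submodule.Quotient.mk_surjective _)

variable [Fintype ι] [LinearOrder ι]

instance finite_H (ε : ℝ) (k j : ℕ) : Module.Finite K ((lerayCosheaf K V ε k).H j) := by
  classical
  have : Module.Finite K ((lerayCosheaf K V ε k).Chains j) := Module.Finite.pi
  exact Module.Finite.of_surjective (homologyClass (lerayCosheaf K V ε k).boundary j)
    (Submodule.Quotient.mk_surjective _)

theorem RepresentsH1.sum {κ : Type*} (s : Finset κ) {c : κ → cycleFamilies K V ε n 1}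
    {y : κ → (lerayCosheaf K V ε n).H 1} (h : ∀ r, RepresentsH1 K V (c r) (y r)) (d : κ → K) :
    RepresentsH1 K V (∑ r ∈ s, d r • c r) (∑ r ∈ s, d r • y r) := by
  classical
  induction s using Finset.induction_on with
  | empty => simpa using RepresentsH1.zero
  | insert a s ha ih =>
    rw [Finset.sum_insert ha, Finset.sum_insert ha]
    exact ((h a).smul _).add ih

/-- Lifts of a basis define choices at a parameter. -/
theorem exists_stageChoice (hN : ∀ σ ∈ nerve V, σ.card ≤ 2) (h : ε ≤ ε')
    {κ : Type*} [Fintype κ] (C : Module.Basis κ K ((lerayCosheaf K V ε n).H 1))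
    (crep : κ → cycleFamilies K V ε n 1) (GamC : κ → (chainCosheaf K V ε (n + 1)).Chains 0)
    (hrep : ∀ s, RepresentsH1 K V (crep s) (C s))
    (hGam : ∀ s, (chainBoundary K V ε n).mapChains 0 (GamC s) = edgeToVertex K V ε n (crep s).1) :
    ∃ S : StageChoice K V h n, (∀ r, S.rep r = ∑ s, C.repr (S.basis r) s • crep s) ∧
      ∀ r, S.Gam r = ∑ s, C.repr (S.basis r) s • GamC s := by
  obtain ⟨A, hA⟩ := Submodule.exists_isCompl (LinearMap.ker (mapH1 K V h n))
  let bA := Module.finBasis K A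
  let bK := Module.finBasis K (LinearMap.ker (mapH1 K V h n))
  -- This is the construction of `StageChoice.basis`, so the two final identities hold by
  -- definition.
  let B := (bA.prod bK).map (Submodule.prodEquivOfIsCompl _ _ hA.symm)
  have hinl : ∀ r, B (Sum.inl r) = bA r := fun r => by simp [B]
  have hinr : ∀ r, B (Sum.inr r) = bK r := fun r => by simp [B]
  have hB : ∀ r, RepresentsH1 K V (∑ s, C.repr (B r) s • crep s) (B r) := fun r => by
    have := RepresentsH1.sum Finset.univ hrep (fun s => C.repr (B r) s)
    rwa [C.sum_repr] at this
  -- A kernel vector becomes zero at the next parameter, so its representative bounds there over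
  -- every edge.
  have hα : ∀ r, ∃ α, (chainBoundary K V ε' n).mapChains 1 α = (chainInclusion K V h n).mapChains 1
      (∑ s, C.repr (B (Sum.inr r)) s • crep s : cycleFamilies K V ε n 1).1 := fun r => by
    have h0 := (hB (Sum.inr r)).map h
    have hker : mapH1 K V h n (B (Sum.inr r)) = 0 := by
      rw [hinr]
      exact LinearMap.mem_ker.1 (bK r).2
    rw [hker] at h0
    exact (representsH1_zero_iff hN).1 h0
  choose α hα using hα
  refine ⟨⟨A, hA.symm, _, _, bA, bK, fun r => ∑ s, C.repr (B r) s • crep s,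
    fun r => hinl r ▸ hB _, fun r => hinr r ▸ hB _,
    fun r => ∑ s, C.repr (B r) s • GamC s, fun r => ?_, α, hα⟩, fun _ => rfl, fun _ => rfl⟩
  simp only [map_sum, map_smul, hGam, Submodule.coe_sum, Submodule.coe_smul]

theorem nonempty_stageChoice (hN : ∀ σ ∈ nerve V, σ.card ≤ 2) (h : ε ≤ ε') :
    Nonempty (StageChoice K V h n) := by
  let C := Module.finBasis K ((lerayCosheaf K V ε n).H 1)
  choose crep hrep using fun s => exists_representsH1 (C s)
  choose GamC hGam using fun s => (hrep s).exists_boundary_eq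
  obtain ⟨S, -⟩ := exists_stageChoice hN h C crep GamC hrep hGam
  exact ⟨S⟩

theorem exists_basis_extending {M : Type*} {M' : Type*} [AddCommGroup M] [Module K M]
    [AddCommGroup M'] [Module K M'] [Module.Finite K M'] {κ : Type*} (b : Module.Basis κ K M)
    {f : M →ₗ[K] M'} (hf : Function.Injective f) :
    ∃ (d : ℕ) (C : Module.Basis (κ ⊕ Fin d) K M'), ∀ r, C (Sum.inl r) = f (b r) := by
  obtain ⟨W, hW⟩ := Submodule.exists_isCompl (LinearMap.range f)
  refine ⟨_, ((b.map (LinearEquiv.ofInjective f hf)).prod (Module.finBasis K W)).map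
    (Submodule.prodEquivOfIsCompl _ _ hW), fun r => by simp⟩

theorem exists_follows (hN : ∀ σ ∈ nerve V, σ.card ≤ 2) {h : ε ≤ ε'} (S : StageChoice K V h n)
    {ε'' : ℝ} (h' : ε' ≤ ε'') : ∃ S' : StageChoice K V h' n, S.Follows S' := by
  -- A meets the kernel trivially, so the images of its basis can be extended to a basis.
  have hinj : Function.Injective (mapH1 K V h n ∘ₗ S.A.subtype) := by
    rw [← LinearMap.ker_eq_bot, LinearMap.ker_comp, ← Submodule.disjoint_iff_comap_eq_bot]
    exact S.isCompl.disjoint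
  obtain ⟨d, C, hC⟩ := exists_basis_extending S.basisA hinj
  choose crep hrep using fun s => exists_representsH1 (C (Sum.inr s))
  choose GamC hGam using fun s => (hrep s).exists_boundary_eq
  have hlrep : ∀ r, RepresentsH1 K V (inclFamily h (S.rep (Sum.inl r))) (C (Sum.inl r)) :=
    fun r => by
      rw [hC]
      exact (S.rep_inl r).map h
  have hlGam : ∀ r, (chainBoundary K V ε' n).mapChains 0
      ((chainInclusion K V h (n + 1)).mapChains 0 (S.Gam (Sum.inl r))) =
      edgeToVertex K V ε' n (inclFamily h (S.rep (Sum.inl r))).1 := fun r => by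
    refine Eq.trans ?_ ((chainInclusion K V h n).mapChains_boundary 0 _)
    exact congrArg ((chainInclusion K V h n).mapChains 0) (S.boundary_Gam (Sum.inl r))
  obtain ⟨S', h1, h2⟩ := exists_stageChoice hN h' C
    (Sum.elim (fun r => inclFamily h (S.rep (Sum.inl r))) crep)
    (Sum.elim (fun r => (chainInclusion K V h (n + 1)).mapChains 0 (S.Gam (Sum.inl r))) GamC)
    (by rintro (r | r); exacts [hlrep r, hrep r]) (by rintro (r | r); exacts [hlGam r, hGam r])
  exact ⟨S', d, C, _, _, hC, fun _ => rfl, fun _ => rfl, hrep, hGam, h1, h2⟩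

theorem nonempty_consistentChoice (hN : ∀ σ ∈ nerve V, σ.card ≤ 2) {N : ℕ}
    (ε : Fin (N + 1) → ℝ) (hε : Monotone ε) : Nonempty (ConsistentChoice K V n ε hε) := by
  let T (i : ℕ) (hi : i < N) := StageChoice K V
    (hε (Fin.castSucc_lt_succ (i := (⟨i, hi⟩ : Fin N))).le) n
  -- Each stage is chosen to follow the previous one, so consistency is the specification of the
  -- choice.
  let st : ∀ (i : ℕ) (hi : i < N), T i hi := fun i => Nat.rec
    (fun hi => Classical.choice (nonempty_stageChoice hN _))
    (fun i S hi => Classical.choose (exists_follows hN (S (Nat.lt_of_succ_lt hi)) _)) i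
  exact ⟨⟨fun i => st i.1 i.2, fun i hi =>
    Classical.choose_spec (exists_follows hN (st i (Nat.lt_of_succ_lt hi)) _)⟩⟩

end Existence

/-! ## The isomorphism of persistence modules -/

section Isomorphism

variable {K : Type u} [Field K] {X : Type v} [MetricSpace X] [Fintype X] {ι : Type w}
  [Fintype ι] [LinearOrder ι] {V : ι → Set X} {n : ℕ}

theorem simplicialHomologyIncl_sumH0 {ε ε' : ℝ} (h : ε ≤ ε') (x : (lerayCosheaf K V ε (n + 1)).H 0) :
    simplicialHomologyIncl K (rips_mono subset_rfl h) (n + 1) (sumH0 K V ε n x) =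
      sumH0 K V ε' n (mapH0 K V h n x) := by
  obtain ⟨z, rfl⟩ := classH0_surjective x
  rw [mapH0_classH0 h z (inclFamily h z) rfl, sumH0_classH0, sumH0_classH0]
  exact simplicialHomologyIncl_vertexClass h _

namespace StageChoice

variable {ε ε' : ℝ} {h : ε ≤ ε'} (S : StageChoice K V h n)

/-- The cycle defining δ(b) differs from the included Γ(b) by -e α, whose sum is zero. -/
theorem sumH0_delta (r : Fin S.b) :
    sumH0 K V ε' n (S.delta (S.basisKer r)) =
      simplicialHomologyIncl K (rips_mono subset_rfl h) (n + 1) (S.toSection (S.basisKer r)) := by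
  rw [delta, Module.Basis.constr_basis, sumH0_classH0, ← basis_inr]
  refine Eq.trans ?_ (congrArg _ (basisSection_apply S.basis S.isLift_Gam (Sum.inr r))).symm
  refine Eq.trans ?_ (simplicialHomologyIncl_vertexClass h _).symm
  rw [← sub_eq_zero, ← map_sub]
  refine vertexClass_eq_zero_of_eq _ (a := 0) (u := -S.alpha r) ?_
  rw [map_zero, map_neg]
  change -edgeToVertex K V ε' (n + 1) (S.alpha r) +
    (chainInclusion K V h (n + 1)).mapChains 0 (S.Gam (Sum.inr r)) -
    (chainInclusion K V h (n + 1)).mapChains 0 (S.Gam (Sum.inr r)) = _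
  abel

theorem psi_basis_inl (r : Fin S.a) : S.psi (S.basis (Sum.inl r)) = 0 := by
  rw [basis_inl, psi, LinearMap.comp_apply, Submodule.projectionOnto_apply_right, map_zero]

theorem psi_basis_inr (r : Fin S.b) : S.psi (S.basis (Sum.inr r)) = S.delta (S.basisKer r) := by
  rw [basis_inr, psi, LinearMap.comp_apply, Submodule.projectionOnto_apply_left]

/-- The isomorphisms defined by sections commute with `Ψ` if the sections are compatible on
`A`. -/
theorem sectionMap_Psi {s' : (lerayCosheaf K V ε' n).H 1 →ₗ[K]
    SimplicialHomology K (rips (Set.univ : Set X) ε') (n + 1)}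
    (hs' : ∀ r, s' (mapH1 K V h n (S.basisA r)) =
      simplicialHomologyIncl K (rips_mono subset_rfl h) (n + 1) (S.toSection (S.basisA r)))
    (y : (lerayCosheaf K V ε (n + 1)).H 0 × (lerayCosheaf K V ε n).H 1) :
    sectionMap s' ((-1) ^ (n + 1)) (S.Psi y) =
      simplicialHomologyIncl K (rips_mono subset_rfl h) (n + 1)
        (sectionMap S.toSection ((-1) ^ (n + 1)) y) := by
  -- ψ measures exactly the failure of the sections to commute with inclusion; this is checked on
  -- the bases of A and of the kernel.
  have key : sumH0 K V ε' n ∘ₗ S.psi + s' ∘ₗ mapH1 K V h n =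
      simplicialHomologyIncl K (rips_mono subset_rfl h) (n + 1) ∘ₗ S.toSection := by
    refine S.basis.ext ?_
    rintro (r | r)
    · change sumH0 K V ε' n (S.psi (S.basis (Sum.inl r))) +
        s' (mapH1 K V h n (S.basis (Sum.inl r))) = simplicialHomologyIncl K _ (n + 1) (S.toSection _)
      rw [psi_basis_inl, basis_inl, hs', map_zero, zero_add]
    · change sumH0 K V ε' n (S.psi (S.basis (Sum.inr r))) +
        s' (mapH1 K V h n (S.basis (Sum.inr r))) = simplicialHomologyIncl K _ (n + 1) (S.toSection _)
      rw [psi_basis_inr, sumH0_delta, basis_inr, LinearMap.mem_ker.1 (S.basisKer r).2, map_zero,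
        add_zero]
  obtain ⟨x, y⟩ := y
  have hy : sumH0 K V ε' n (S.psi y) + s' (mapH1 K V h n y) =
    simplicialHomologyIncl K (rips_mono subset_rfl h) (n + 1) (S.toSection y) :=
      LinearMap.congr_fun key y
  change sumH0 K V ε' n (mapH0 K V h n x + (-1 : K) ^ (n + 1) • S.psi y) +
    (-1 : K) ^ (n + 1) • s' (mapH1 K V h n y) = simplicialHomologyIncl K _ (n + 1)
      (sumH0 K V ε n x + (-1 : K) ^ (n + 1) • S.toSection y)
  rw [map_add, map_add, map_smul, map_smul, ← hy, simplicialHomologyIncl_sumH0, smul_add, add_assoc]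

end StageChoice

/-- The last parameter has no choices of its own. An auxiliary stage there, whose next parameter is
the same one and which follows the last given stage, supplies the missing section. -/
theorem exists_sections (hN : ∀ σ ∈ nerve V, σ.card ≤ 2) {N : ℕ}
    {ε : Fin (N + 1) → ℝ} {hε : Monotone ε} (S : ConsistentChoice K V n ε hε) :
    ∃ s : ∀ i, (lerayCosheaf K V (ε i) n).H 1 →ₗ[K]
        SimplicialHomology K (rips (Set.univ : Set X) (ε i)) (n + 1),
      (∀ i, IsSection (s i)) ∧ (∀ i : Fin N, s i.castSucc = (S.stage i).toSection) ∧
      ∀ (i : Fin N) (r : Fin (S.stage i).a),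
        s i.succ (mapH1 K V (hε (Fin.castSucc_lt_succ (i := i)).le) n ((S.stage i).basisA r)) =
          simplicialHomologyIncl K (rips_mono subset_rfl (hε (Fin.castSucc_lt_succ (i := i)).le))
            (n + 1) ((S.stage i).toSection ((S.stage i).basisA r)) := by
  cases N with
  | zero =>
    -- With a single parameter there is nothing to be compatible with, and any section will do.
    obtain ⟨L⟩ := nonempty_stageChoice (K := K) (n := n) hN (le_refl (ε 0))
    refine ⟨fun i => Fin.cases L.toSection (fun j => j.elim0) i, fun i => ?_, fun i => i.elim0,
      fun i => i.elim0⟩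
    obtain rfl : i = 0 := Subsingleton.elim (α := Fin 1) _ _
    exact L.isSection_toSection
  | succ M =>
    obtain ⟨L, hL⟩ := exists_follows hN (S.stage (Fin.last M)) (le_refl (ε (Fin.last (M + 1))))
    let s : ∀ i, (lerayCosheaf K V (ε i) n).H 1 →ₗ[K]
        SimplicialHomology K (rips (Set.univ : Set X) (ε i)) (n + 1) :=
      Fin.lastCases L.toSection fun i => (S.stage i).toSection
    have hcs : ∀ i : Fin (M + 1), s i.castSucc = (S.stage i).toSection := fun i =>
      Fin.lastCases_castSucc ..
    have hl : s (Fin.last (M + 1)) = L.toSection := Fin.lastCases_last ..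
    refine ⟨s, Fin.lastCases ?_ fun i => ?_, hcs, Fin.lastCases (fun r => ?_) fun i r => ?_⟩
    · rw [hl]; exact L.isSection_toSection
    · rw [hcs]; exact (S.stage i).isSection_toSection
    · exact (LinearMap.congr_fun hl _).trans (hL.toSection_basisA r)
    · have hf : StageChoice.Follows (S.stage i.castSucc) (S.stage i.succ) :=
        S.follows i.1 (Nat.succ_lt_succ i.2)
      have h := hf.toSection_basisA r
      rw [← hcs i.succ] at h
      exact h

theorem psiModule_isomorphic (hN : ∀ σ ∈ nerve V, σ.card ≤ 2) {N : ℕ}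
    {ε : Fin (N + 1) → ℝ} {hε : Monotone ε}
    (hR : ∀ i, ∀ s ∈ rips (Set.univ : Set X) (ε i), ∃ j, (s : Set X) ⊆ V j)
    (S : ConsistentChoice K V n ε hε) :
    (psiModule K V S).Isomorphic (ripsModule (X := X) K n ε hε) := by
  obtain ⟨s, hs, hs1, hs2⟩ := exists_sections hN S
  have hr : ((-1 : K) ^ (n + 1)) ≠ 0 := pow_ne_zero _ (neg_ne_zero.2 one_ne_zero)
  refine ⟨fun i => LinearEquiv.ofBijective (sectionMap (s i) ((-1) ^ (n + 1)))
    ⟨sectionMap_injective hN (hR i) (hs i) hr, sectionMap_surjective hN (hR i) (hs i) hr⟩,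
    fun i y => ?_⟩
  have h := (S.stage i).sectionMap_Psi (hs2 i) y
  rw [← hs1] at h
  exact h

end Isomorphism

end DistPH

end

theorem mainTheorem1 {K : Type*} [Field K] {m : ℕ} (P : Finset (EuclideanSpace ℝ (Fin m)))
    {ι : Type*} [Fintype ι] [LinearOrder ι] (V : ι → Set P)
    (hcover : ⋃ i, V i = Set.univ)
    (hnerve : ∀ σ ∈ DistPH.nerve V, σ.card ≤ 2) :
    0 < DistPH.epsStar V ∧
    ∀ (n N : ℕ) (ε : Fin (N + 1) → ℝ) (hε : Monotone ε),
      (∀ i, 0 < ε i) → (∀ i, ENNReal.ofReal (ε i) < DistPH.epsStar V) →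
      Nonempty (DistPH.ConsistentChoice K V n ε hε) ∧
      ∀ S : DistPH.ConsistentChoice K V n ε hε,
        (DistPH.psiModule K V S).Isomorphic (DistPH.ripsModule (X := P) K n ε hε) :=
  ⟨DistPH.epsStar_pos V, fun _ _ ε hε _ hlt => ⟨DistPH.nonempty_consistentChoice hnerve ε hε,
    DistPH.psiModule_isomorphic hnerve fun i _ hs =>
      DistPH.exists_subset_of_mem_rips hcover (hlt i) hs⟩⟩
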